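/- Let $M$ be a smooth $n$-dimensional manifold with a torsion-free smooth connection $\hat\nabla$ on $TM$, let $E\to M$ be a smooth real vector bundle of finite rank with a smooth connection $\nabla$, and let $p\in M$. Write $\otimes(W)$, $S(W)$, $\wedge(W)$ for the tensor, symmetric and exterior algebras of a real vector space $W$, and $\boxtimes$ for the tensor product over $\mathbb R$. Let $\nabla$ also denote the connections induced on $\wedge(E^*)$ and on $\mathrm{Hom}(TM\otimes TM\otimes E,E)$ by duality and the Leibniz rule, using $\hat\nabla$ on $TM$. For smooth vector fields $X_0,\dots,X_j$ define the higher covariant derivatives on sections by $\nabla^0=\mathrm{id}$ and $$\nabla^{j+1}_{X_0,\dots,X_j}=\nabla_{X_0}\circ\nabla^{j}_{X_1,\dots,X_j}-\sum_{k=1}^{j}\nabla^{j}_{X_1,\dots,\hat\nabla_{X_0}X_k,\dots,X_j},$$ and let $R^E_{X,Y}=\nabla^2_{X,Y}-\nabla^2_{Y,X}$ be the curvature of $E$; $R^{TM}$ is the curvature of $\hat\nabla$. Define the linear map $$\Phi_p:\otimes(T_pM)\boxtimes\wedge(E_p)\to[C^\infty(\wedge(E^*))]^*,\qquad \Phi_p\big((v_1\otimes\cdots\otimes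 v_j)\boxtimes\alpha\big)(\omega)=\big(\nabla^j_{\tilde v_1,\dots,\tilde v_j}\omega\big)_p(\alpha),$$ where $\tilde v_i$ is any smooth vector field on $M$ with $\tilde v_i(p)=v_i$ and the pairing of $\wedge(E_p^*)$ with $\wedge(E_p)$ is the determinant pairing. Let $\mathcal U_k^r(E;p)$ be the image under $\Phi_p$ of $\otimes^{\le r}(T_pM)\boxtimes\wedge^k(E_p)$, and let $\mathcal U(E;p)=\sum_{r,k}\mathcal U_k^r(E;p)$. The following are equivalent: 1. $\ker(\Phi_p)$ is a two-sided ideal of the algebra $\otimes(T_pM)\boxtimes\wedge(E_p)$; 2. $M$ and $E$ are asymptotically flat at $p$, that is, $(\hat\nabla^jR^{TM})(p)=0$ and $(\nabla^jR^E)(p)=0$ for all $j\ge 0$; 3. $\Phi_p$ factors through the natural projection $\otimes(T_pM)\boxtimes\wedge(E_p)\to S(T_pM)\boxtimes\wedge(E_p)$. If any of these holds, then $\Phi_p$ descends to a linear isomorphism $S(T_pM)\boxtimes\wedge(E_p)\cong\mathcal U(E;p)$, and this isomorphism maps $S^{\le r}(T_pM)\boxtimes\wedge^k(E_p)$ onto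 $\mathcal U_k^r(E;p)$ for all $r,k\ge 0$. -/

import Mathlib

open Bundle Function
open scoped Manifold ContDiff Topology TensorProduct

noncomputable section

namespace CovJet

section Sections

variable {B : Type*} [NormedAddCommGroup B] [NormedSpace ℝ B]
  {M : Type*} [TopologicalSpace M] [ChartedSpace B M]

variable (B M) in
/-- Smooth vector fields on `M`. -/
abbrev VecField [IsManifold 𝓘(ℝ, B) ∞ M] : Type _ :=
  Cₛ^∞⟮𝓘(ℝ, B); B, (TangentSpace 𝓘(ℝ, B) : M → Type _)⟯

variable [IsManifold 𝓘(ℝ, B) ∞ M]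

/-- The derivative `X f` of a smooth function along a smooth vector field. -/
def dirDeriv (X : VecField B M) (f : C^∞⟮𝓘(ℝ, B), M; ℝ⟯) : C^∞⟮𝓘(ℝ, B), M; ℝ⟯ :=
  ⟨fun x ↦ mvfderiv 𝓘(ℝ, B) f x (X x), by
    have h := (contMDiff_snd_tangentBundle_modelSpace ℝ 𝓘(ℝ, ℝ) (n := ∞)).comp
      ((f.contMDiff.contMDiff_tangentMap (m := ∞) le_rfl).comp X.contMDiff)
    exact h⟩

theorem dirDeriv_add_left (X Y : VecField B M) (f : C^∞⟮𝓘(ℝ, B), M; ℝ⟯) :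
    dirDeriv (X + Y) f = dirDeriv X f + dirDeriv Y f := by
  ext x; exact (mvfderiv 𝓘(ℝ, B) f x).map_add (X x) (Y x)

theorem dirDeriv_smul_left (c : ℝ) (X : VecField B M) (f : C^∞⟮𝓘(ℝ, B), M; ℝ⟯) :
    dirDeriv (c • X) f = c • dirDeriv X f := by
  ext x; exact (mvfderiv 𝓘(ℝ, B) f x).map_smul c (X x)

theorem mdiff (f : C^∞⟮𝓘(ℝ, B), M; ℝ⟯) (x : M) : MDifferentiableAt 𝓘(ℝ, B) 𝓘(ℝ, ℝ) f x :=
  f.contMDiff.mdifferentiable (by simp) x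

theorem dirDeriv_add (X : VecField B M) (f g : C^∞⟮𝓘(ℝ, B), M; ℝ⟯) :
    dirDeriv X (f + g) = dirDeriv X f + dirDeriv X g := by
  ext x
  exact congrArg (· (X x)) (mvfderiv_add (mdiff f x) (mdiff g x))

theorem dirDeriv_mul (X : VecField B M) (f g : C^∞⟮𝓘(ℝ, B), M; ℝ⟯) :
    dirDeriv X (f * g) = f * dirDeriv X g + dirDeriv X f * g := by
  ext x
  have := congrArg (· (X x)) (mvfderiv_mul (mdiff f x) (mdiff g x))
  refine this.trans ?_
  change f x * mvfderiv 𝓘(ℝ, B) g x (X x) + g x * mvfderiv 𝓘(ℝ, B) f x (X x) =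
    f x * mvfderiv 𝓘(ℝ, B) g x (X x) + mvfderiv 𝓘(ℝ, B) f x (X x) * g x
  ring

theorem dirDeriv_smul (c : ℝ) (X : VecField B M) (f : C^∞⟮𝓘(ℝ, B), M; ℝ⟯) :
    dirDeriv X (c • f) = c • dirDeriv X f := by
  ext x
  have := congrArg (· (X x)) (mvfderiv_mul (I := 𝓘(ℝ, B)) (f := fun _ ↦ c)
    mdifferentiableAt_const (mdiff f x))
  refine this.trans ?_
  rw [mvfderiv_const, smul_zero, add_zero]
  rfl

variable {F : Type*} [NormedAddCommGroup F] [NormedSpace ℝ F]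
  {V : M → Type*} [TopologicalSpace (TotalSpace F V)]
  [∀ x, AddCommGroup (V x)] [∀ x, Module ℝ (V x)] [∀ x, TopologicalSpace (V x)]
  [FiberBundle F V] [VectorBundle ℝ F V]

variable (B F V) in
/-- Smooth sections of the bundle `V`. -/
abbrev Sec : Type _ := Cₛ^∞⟮𝓘(ℝ, B); F, V⟯

/-- The product of a smooth function and a smooth section. -/
def fmul (f : C^∞⟮𝓘(ℝ, B), M; ℝ⟯) (s : Sec B F V) : Sec B F V :=
  ⟨(f : M → ℝ) • (s : Π x, V x), f.contMDiff.smul_section s.contMDiff⟩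

theorem dirDeriv_fmul_left (f : C^∞⟮𝓘(ℝ, B), M; ℝ⟯) (X : VecField B M)
    (g : C^∞⟮𝓘(ℝ, B), M; ℝ⟯) : dirDeriv (fmul f X) g = f * dirDeriv X g := by
  ext x; exact (mvfderiv 𝓘(ℝ, B) g x).map_smul (f x) (X x)

variable (B F) in
/-- Evaluation of smooth sections at a point. -/
def evalAt (x : M) : Sec B F V →ₗ[ℝ] V x where
  toFun s := s x
  map_add' _ _ := rfl
  map_smul' _ _ := rfl

theorem sec_mdiff (s : Sec B F V) (x : M) :
    MDifferentiableAt 𝓘(ℝ, B) (𝓘(ℝ, B).prod 𝓘(ℝ, F))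
      (fun y ↦ TotalSpace.mk' F y (s y)) x :=
  s.contMDiff.mdifferentiable (by simp) x

section Extension

variable [FiniteDimensional ℝ B] [FiniteDimensional ℝ F] [T2Space M]
  [ContMDiffVectorBundle ∞ F V 𝓘(ℝ, B)]

/-- Around each point there are finitely many global smooth sections and a cut-off function `χ`
such that each section, multiplied by `χ ^ 2`, is a combination of these sections, with
coefficients at the given point that depend only on the value there. -/
theorem exists_frame (x : M) :
    ∃ (e : Fin (Module.finrank ℝ F) → Sec B F V) (χ : C^∞⟮𝓘(ℝ, B), M; ℝ⟯), χ x = 1 ∧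
      (∀ v : V x, ∃ a : Fin (Module.finrank ℝ F) → ℝ, v = ∑ i, a i • e i x) ∧
      ∀ s : Sec B F V, ∃ c : Fin (Module.finrank ℝ F) → C^∞⟮𝓘(ℝ, B), M; ℝ⟯,
        fmul (χ * χ) s = ∑ i, fmul (c i) (e i) ∧ (s x = 0 → ∀ i, c i x = 0) := by
  have : ContMDiffVectorBundle 1 F V 𝓘(ℝ, B) := ContMDiffVectorBundle.of_le (n := ∞) (by simp)
  let t := trivializationAt F V x
  let b := Module.finBasis ℝ F
  have hx : x ∈ t.baseSet := FiberBundle.mem_baseSet_trivializationAt F V x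
  obtain ⟨ρ, -, hρ⟩ := (SmoothBumpFunction.nhds_basis_tsupport (I := 𝓘(ℝ, B)) x).mem_iff.1
    (t.open_baseSet.mem_nhds hx)
  let χ : C^∞⟮𝓘(ℝ, B), M; ℝ⟯ := ⟨ρ, ρ.contMDiff⟩
  let e : Fin (Module.finrank ℝ F) → Sec B F V := fun i ↦
    ⟨(ρ : M → ℝ) • t.localFrame b i, ContMDiffOn.smul_section_of_tsupport
      ρ.contMDiff.contMDiffOn t.open_baseSet hρ (t.contMDiffOn_localFrame_baseSet ∞ b i)⟩
  have hρx : ρ x = 1 := ρ.eq_one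
  refine ⟨e, χ, hρx, fun v ↦ ?_, fun s ↦ ?_⟩
  · refine ⟨fun i ↦ (t.basisAt b hx).repr v i, ?_⟩
    conv_lhs => rw [← (t.basisAt b hx).sum_repr v]
    refine Finset.sum_congr rfl fun i _ ↦ ?_
    change _ = _ • (ρ x • t.localFrame b i x)
    rw [hρx, one_smul, t.localFrame_apply_of_mem_baseSet b hx]
  · have hc : ∀ i, ContMDiff 𝓘(ℝ, B) 𝓘(ℝ, ℝ) ∞
        (fun y ↦ ρ y * t.localFrameCoeff 𝓘(ℝ, B) b i y (s y)) := by
      intro i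
      have h1 := contMDiffOn_baseSet_localFrameCoeff (e := t) b (k := ∞) (s := fun y ↦ s y)
        (s.contMDiff.contMDiffOn) i
      refine contMDiff_of_tsupport fun y hy ↦ ?_
      have hy' : y ∈ t.baseSet := hρ (tsupport_mul_subset_left hy)
      exact ρ.contMDiff.contMDiffAt.mul ((h1 y hy').contMDiffAt (t.open_baseSet.mem_nhds hy'))
    refine ⟨fun i ↦ ⟨_, hc i⟩, ?_, ?_⟩
    · ext y
      rw [show (∑ i, fmul (⟨_, hc i⟩ : C^∞⟮𝓘(ℝ, B), M; ℝ⟯) (e i)) y =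
        ∑ i, evalAt B F y (fmul (⟨_, hc i⟩ : C^∞⟮𝓘(ℝ, B), M; ℝ⟯) (e i)) from
          map_sum (evalAt B F y) _ _]
      change (ρ y * ρ y) • s y =
        ∑ i, (ρ y * t.localFrameCoeff 𝓘(ℝ, B) b i y (s y)) • (ρ y • t.localFrame b i y)
      by_cases hy : y ∈ t.baseSet
      · conv_lhs => rw [t.eq_sum_localFrameCoeff_smul (I := 𝓘(ℝ, B)) (b := b) (s := s) hy]
        rw [Finset.smul_sum]
        refine Finset.sum_congr rfl fun i _ ↦ ?_
        simp only [smul_smul]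
        congr 1
        ring
      · have : ρ y = 0 := by
          by_contra h
          exact hy (hρ (subset_tsupport _ h))
        simp [this]
    · intro h i
      change ρ x * t.localFrameCoeff 𝓘(ℝ, B) b i x (s x) = 0
      rw [h, map_zero, mul_zero]

theorem sec_sum_apply {ι : Type*} (t : Finset ι) (s : ι → Sec B F V) (x : M) :
    (∑ i ∈ t, s i) x = ∑ i ∈ t, s i x := map_sum (evalAt B F x) _ _

theorem evalAt_surjective (x : M) : Surjective (evalAt B F (V := V) x) := by
  obtain ⟨e, -, -, h, -⟩ := exists_frame (B := B) (F := F) (V := V) x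
  intro v
  obtain ⟨a, ha⟩ := h v
  exact ⟨∑ i, a i • e i, by rw [map_sum, ha]; rfl⟩

/-- A choice of smooth extensions of the vectors in the fibre over `x`, linear in the vector. -/
def extSec (x : M) : V x →ₗ[ℝ] Sec B F V :=
  ((evalAt B F x).exists_rightInverse_of_surjective
    (LinearMap.range_eq_top.2 (evalAt_surjective x))).choose

@[simp]
theorem extSec_apply_self (x : M) (v : V x) : (extSec x v : Sec B F V) x = v :=
  LinearMap.congr_fun ((evalAt B F x).exists_rightInverse_of_surjective
    (LinearMap.range_eq_top.2 (evalAt_surjective x))).choose_spec v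

/-- A linear operation that is tensorial at `x` vanishes on the sections that vanish at `x`. -/
theorem tensorial_zero {x : M} {W : Type*} [AddCommGroup W] [Module ℝ W]
    (L : Sec B F V →ₗ[ℝ] W) (hL : ∀ f s, L (fmul f s) = f x • L s)
    (s : Sec B F V) (hs : s x = 0) : L s = 0 := by
  obtain ⟨e, χ, hχ, -, h⟩ := exists_frame (B := B) (F := F) (V := V) x
  obtain ⟨c, hc, h0⟩ := h s
  have h1 : L (fmul (χ * χ) s) = L s := by rw [hL]; simp [hχ]
  rw [← h1, hc, map_sum]
  exact Finset.sum_eq_zero fun i _ ↦ by rw [hL, h0 hs i, zero_smul]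

/-- A multilinear operation that is tensorial at `x` depends only on the values at `x`. -/
theorem tensorial_congr {x : M} {W : Type*} [AddCommGroup W] [Module ℝ W] {k : ℕ}
    (L : MultilinearMap ℝ (fun _ : Fin k ↦ Sec B F V) W)
    (hL : ∀ Y i f, L (update Y i (fmul f (Y i))) = f x • L Y)
    (Y Z : Fin k → Sec B F V) (h : ∀ i, Y i x = Z i x) : L Y = L Z := by
  classical
  suffices H : ∀ t : Finset (Fin k), L (fun i ↦ if i ∈ t then Z i else Y i) = L Y by
    simpa using (H Finset.univ).symm
  intro t
  induction t using Finset.induction_on with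
  | empty => simp
  | insert a t ha ih =>
    rw [← ih]
    set W := (fun i ↦ if i ∈ t then Z i else Y i) with hW
    have e1 : (fun i ↦ if i ∈ insert a t then Z i else Y i) = update W a (Z a) := by
      ext1 i
      by_cases hi : i = a
      · subst hi; simp
      · simp [hi, hW]
    have e2 : W = update W a (Y a) := by
      ext1 i
      by_cases hi : i = a
      · subst hi; simp [hW, ha]
      · simp [hi]
    rw [e1]
    conv_rhs => rw [e2]
    rw [← sub_eq_zero, ← L.map_update_sub]
    refine tensorial_zero (x := x) (L.toLinearMap W a) (fun f s ↦ ?_) _ ?_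
    · simpa using hL (update W a s) a f
    · exact sub_eq_zero.2 (h a).symm

end Extension

end Sections

section Connections

variable {B : Type*} [NormedAddCommGroup B] [NormedSpace ℝ B]
  {M : Type*} [TopologicalSpace M] [ChartedSpace B M] [IsManifold 𝓘(ℝ, B) ∞ M]
  {F : Type*} [NormedAddCommGroup F] [NormedSpace ℝ F]
  {V : M → Type*} [TopologicalSpace (TotalSpace F V)]
  [∀ x, AddCommGroup (V x)] [∀ x, Module ℝ (V x)] [∀ x, TopologicalSpace (V x)]
  [∀ x, IsTopologicalAddGroup (V x)] [∀ x, ContinuousSMul ℝ (V x)]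
  [FiberBundle F V] [VectorBundle ℝ F V]

/-- The operator `(X, s) ↦ ∇_X s` of a smooth connection on smooth vector fields and smooth
sections. -/
def nabla [ContMDiffVectorBundle ∞ F V 𝓘(ℝ, B)]
    (cov : CovariantDerivative 𝓘(ℝ, B) F V)
    [hcov : CovariantDerivative.ContMDiffCovariantDerivative cov ∞]
    (X : VecField B M) (s : Sec B F V) : Sec B F V :=
  ⟨fun x ↦ cov s x (X x), by
    have h := hcov.contMDiff.contMDiff (σ := s) s.contMDiff.contMDiffOn
    exact (contMDiffOn_univ.1 h).clm_bundle_apply X.contMDiff⟩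

variable [ContMDiffVectorBundle ∞ F V 𝓘(ℝ, B)]
  (cov : CovariantDerivative 𝓘(ℝ, B) F V)
  [hcov : CovariantDerivative.ContMDiffCovariantDerivative cov ∞]

theorem nabla_add_left (X Y : VecField B M) (s : Sec B F V) :
    nabla cov (X + Y) s = nabla cov X s + nabla cov Y s := by
  ext x; exact (cov s x).map_add (X x) (Y x)

theorem nabla_smul_left (c : ℝ) (X : VecField B M) (s : Sec B F V) :
    nabla cov (c • X) s = c • nabla cov X s := by
  ext x; exact (cov s x).map_smul c (X x)

theorem nabla_fmul_left (f : C^∞⟮𝓘(ℝ, B), M; ℝ⟯) (X : VecField B M) (s : Sec B F V) :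
    nabla cov (fmul f X) s = fmul f (nabla cov X s) := by
  ext x; exact (cov s x).map_smul (f x) (X x)

theorem nabla_add (X : VecField B M) (s t : Sec B F V) :
    nabla cov X (s + t) = nabla cov X s + nabla cov X t := by
  ext x
  exact congrArg (· (X x)) (cov.isCovariantDerivativeOnUniv.add (sec_mdiff s x) (sec_mdiff t x))

theorem nabla_fmul (X : VecField B M) (f : C^∞⟮𝓘(ℝ, B), M; ℝ⟯) (s : Sec B F V) :
    nabla cov X (fmul f s) = fmul f (nabla cov X s) + fmul (dirDeriv X f) s := by
  ext x
  exact congrArg (· (X x)) (cov.isCovariantDerivativeOnUniv.leibniz (sec_mdiff s x) (mdiff f x))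

theorem nabla_smul (X : VecField B M) (c : ℝ) (s : Sec B F V) :
    nabla cov X (c • s) = c • nabla cov X s := by
  ext x
  exact congrArg (· (X x)) (cov.isCovariantDerivativeOnUniv.smul_const c (sec_mdiff s x))

/-- `nabla` as a linear map in the section. -/
def nablaLin (X : VecField B M) : Sec B F V →ₗ[ℝ] Sec B F V where
  toFun := nabla cov X
  map_add' := nabla_add cov X
  map_smul' := nabla_smul cov X

end Connections

section HigherDerivative

variable {X G : Type*} [AddCommGroup X] [AddCommGroup G]

/-- The higher covariant derivative `∇^j_{Y₁,…,Y_j} s`, given a connection `nT` on vector fields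
and a connection `n` on sections:
`∇^{j+1}_{Y₀,…,Y_j} = ∇_{Y₀} ∘ ∇^j_{Y₁,…,Y_j} - ∑ₖ ∇^j_{Y₁,…,∇_{Y₀}Yₖ,…,Y_j}`. -/
def higher (nT : X → X → X) (n : X → G → G) : (j : ℕ) → (Fin j → X) → G → G
  | 0, _, s => s
  | j + 1, Y, s => n (Y 0) (higher nT n j (Fin.tail Y) s) -
      ∑ k : Fin j, higher nT n j (update (Fin.tail Y) k (nT (Y 0) (Fin.tail Y k))) s

section Linearity

variable [Module ℝ X] [Module ℝ G] (nT : X →ₗ[ℝ] X →ₗ[ℝ] X) (n : X →ₗ[ℝ] G →ₗ[ℝ] G)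

theorem higher_add_smul (j : ℕ) (Y : Fin j → X) (c : ℝ) (s t : G) :
    higher (fun a b ↦ nT a b) (fun a b ↦ n a b) j Y (s + c • t) =
      higher (fun a b ↦ nT a b) (fun a b ↦ n a b) j Y s +
        c • higher (fun a b ↦ nT a b) (fun a b ↦ n a b) j Y t := by
  induction j with
  | zero => rfl
  | succ j ih =>
    simp only [higher, ih, map_add, map_smul, Finset.sum_add_distrib, ← Finset.smul_sum, smul_sub]
    abel

theorem higher_update (j : ℕ) (Y : Fin j → X) (i : Fin j) (c : ℝ) (a b : X) (s : G) :
    higher (fun a b ↦ nT a b) (fun a b ↦ n a b) j (update Y i (a + c • b)) s =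
      higher (fun a b ↦ nT a b) (fun a b ↦ n a b) j (update Y i a) s +
        c • higher (fun a b ↦ nT a b) (fun a b ↦ n a b) j (update Y i b) s := by
  induction j generalizing a b with
  | zero => exact i.elim0
  | succ j ih =>
    refine Fin.cases ?_ (fun i ↦ ?_) i
    · simp only [higher, Fin.tail_update_zero, update_self, map_add, map_smul,
        LinearMap.add_apply, LinearMap.smul_apply, ih, Finset.sum_add_distrib, ← Finset.smul_sum,
        smul_sub]
      abel
    · have h0 : ∀ x : X, update Y i.succ x 0 = Y 0 := fun x ↦
        update_of_ne (Fin.succ_ne_zero i).symm _ _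
      have key : ∀ x : X, higher (fun a b ↦ nT a b) (fun a b ↦ n a b) (j + 1)
          (update Y i.succ x) s =
          n (Y 0) (higher (fun a b ↦ nT a b) (fun a b ↦ n a b) j (update (Fin.tail Y) i x) s) -
          (higher (fun a b ↦ nT a b) (fun a b ↦ n a b) j
              (update (Fin.tail Y) i (nT (Y 0) x)) s +
            ∑ k ∈ Finset.univ.erase i, higher (fun a b ↦ nT a b) (fun a b ↦ n a b) j
              (update (update (Fin.tail Y) k (nT (Y 0) (Fin.tail Y k))) i x) s) := by
        intro x
        rw [higher, h0, Fin.tail_update_succ, ← Finset.add_sum_erase _ _ (Finset.mem_univ i)]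
        congr 2
        · simp
        · refine Finset.sum_congr rfl fun l hl ↦ ?_
          have hl' : l ≠ i := Finset.ne_of_mem_erase hl
          rw [update_of_ne hl', update_comm hl']
      simp only [key, ih, map_add, map_smul, Finset.sum_add_distrib, ← Finset.smul_sum, smul_sub,
        smul_add]
      abel

/-- The higher covariant derivative as a multilinear map. -/
def higherMul (j : ℕ) : MultilinearMap ℝ (fun _ : Fin j ↦ X) (G →ₗ[ℝ] G) where
  toFun Y :=
    { toFun := higher (fun a b ↦ nT a b) (fun a b ↦ n a b) j Y
      map_add' := fun s t ↦ by simpa using higher_add_smul nT n j Y 1 s t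
      map_smul' := fun c t ↦ by
        have h0 := higher_add_smul nT n j Y 1 0 0
        have h := higher_add_smul nT n j Y c 0 t
        simp only [one_smul, add_zero, left_eq_add, zero_add] at h0 h
        simpa [h0] using h }
  map_update_add' := by
    intro inst Y i a b
    obtain rfl : inst = instDecidableEqFin j := Subsingleton.elim _ _
    ext s
    have := higher_update nT n j Y i 1 a b s
    rw [one_smul, one_smul] at this
    exact this
  map_update_smul' := by
    intro inst Y i c b
    obtain rfl : inst = instDecidableEqFin j := Subsingleton.elim _ _
    ext s
    have h0 := higher_update nT n j Y i 1 0 0 s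
    have h := higher_update nT n j Y i c 0 b s
    simp only [one_smul, add_zero, left_eq_add, zero_add] at h0 h
    rw [h0, zero_add] at h
    exact h

/-- If both connections satisfy the Leibniz rule, then the higher covariant derivative is
tensorial in the vector fields. -/
theorem higher_tensorial {A : Type*} (mX : A → X → X) (mG : A → G →+ G) (d : X → A → A)
    (h1 : ∀ f x y, nT (mX f x) y = mX f (nT x y))
    (h2 : ∀ f x y, nT x (mX f y) = mX f (nT x y) + mX (d x f) y)
    (h3 : ∀ f x s, n (mX f x) s = mG f (n x s))
    (h4 : ∀ f x s, n x (mG f s) = mG f (n x s) + mG (d x f) s)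
    (j : ℕ) (Y : Fin j → X) (i : Fin j) (f : A) (x : X) (s : G) :
    higherMul nT n j (update Y i (mX f x)) s = mG f (higherMul nT n j (update Y i x) s) := by
  have hs : ∀ (j : ℕ) (Y : Fin (j + 1) → X), higherMul nT n (j + 1) Y s =
      n (Y 0) (higherMul nT n j (Fin.tail Y) s) -
        ∑ k : Fin j, higherMul nT n j (update (Fin.tail Y) k (nT (Y 0) (Fin.tail Y k))) s :=
    fun _ _ ↦ rfl
  induction j generalizing f x with
  | zero => exact i.elim0
  | succ j ih =>
    induction i using Fin.cases with
    | zero =>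
      simp only [hs, Fin.tail_update_zero, update_self, h3, h1, ih, map_sub, map_sum]
    | succ i =>
      have h0 : ∀ x : X, update Y i.succ x 0 = Y 0 := fun x ↦
        update_of_ne (Fin.succ_ne_zero i).symm _ _
      have key : ∀ x : X, higherMul nT n (j + 1) (update Y i.succ x) s =
          n (Y 0) (higherMul nT n j (update (Fin.tail Y) i x) s) -
          (higherMul nT n j (update (Fin.tail Y) i (nT (Y 0) x)) s +
            ∑ k ∈ Finset.univ.erase i, higherMul nT n j
              (update (update (Fin.tail Y) k (nT (Y 0) (Fin.tail Y k))) i x) s) := by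
        intro x
        rw [hs, h0, Fin.tail_update_succ, ← Finset.add_sum_erase _ _ (Finset.mem_univ i)]
        congr 2
        · simp
        · refine Finset.sum_congr rfl fun l hl ↦ ?_
          have hl' : l ≠ i := Finset.ne_of_mem_erase hl
          rw [update_of_ne hl', update_comm hl']
      simp only [key, ih, h2, h4, MultilinearMap.map_update_add, LinearMap.add_apply, map_sub,
        map_add, map_sum]
      abel

end Linearity

end HigherDerivative

section Curvature

variable {B : Type*} [NormedAddCommGroup B] [NormedSpace ℝ B]
  {M : Type*} [TopologicalSpace M] [ChartedSpace B M] [IsManifold 𝓘(ℝ, B) ∞ M]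
  {F : Type*} [NormedAddCommGroup F] [NormedSpace ℝ F]
  {V : M → Type*} [TopologicalSpace (TotalSpace F V)]
  [∀ x, AddCommGroup (V x)] [∀ x, Module ℝ (V x)] [∀ x, TopologicalSpace (V x)]
  [∀ x, IsTopologicalAddGroup (V x)] [∀ x, ContinuousSMul ℝ (V x)]
  [FiberBundle F V] [VectorBundle ℝ F V]
  [ContMDiffVectorBundle ∞ F V 𝓘(ℝ, B)]
  (covT : CovariantDerivative 𝓘(ℝ, B) B (TangentSpace 𝓘(ℝ, B) : M → Type _))
  [CovariantDerivative.ContMDiffCovariantDerivative covT ∞]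
  (cov : CovariantDerivative 𝓘(ℝ, B) F V)
  [CovariantDerivative.ContMDiffCovariantDerivative cov ∞]

/-- The curvature `R_{a,b} s = ∇²_{a,b} s - ∇²_{b,a} s`. -/
def curv (a b : VecField B M) (s : Sec B F V) : Sec B F V :=
  higher (nabla covT) (nabla cov) 2 ![a, b] s - higher (nabla covT) (nabla cov) 2 ![b, a] s

/-- The connection induced on the bundle `Hom(TM ⊗ TM ⊗ V, V)`; a section of this bundle is given
by its action on vector fields and sections. -/
def nablaHom (X : VecField B M)
    (T : VecField B M → VecField B M → Sec B F V → Sec B F V) :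
    VecField B M → VecField B M → Sec B F V → Sec B F V :=
  fun a b s ↦ nabla cov X (T a b s) - T (nabla covT X a) b s - T a (nabla covT X b) s -
    T a b (nabla cov X s)

/-- `V` is asymptotically flat at `p`: for each `j`, the tensor `∇^j R` vanishes at `p`. -/
def AsympFlat (p : M) : Prop :=
  ∀ (j : ℕ) (Y : Fin j → VecField B M) (a b : VecField B M) (s : Sec B F V),
    (higher (nabla covT) (nablaHom covT cov) j Y (curv covT cov) a b s) p = 0

end Curvature

section Forms

variable {B : Type*} [NormedAddCommGroup B] [NormedSpace ℝ B]
  {M : Type*} [TopologicalSpace M] [ChartedSpace B M] [IsManifold 𝓘(ℝ, B) ∞ M]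
  {F : Type*} [NormedAddCommGroup F] [NormedSpace ℝ F]
  {V : M → Type*} [TopologicalSpace (TotalSpace F V)]
  [∀ x, AddCommGroup (V x)] [∀ x, Module ℝ (V x)] [∀ x, TopologicalSpace (V x)]
  [FiberBundle F V] [VectorBundle ℝ F V]

variable (B F V) in
/-- Smooth sections of `∧^k(V*)`. The fibre `∧^k(V_x*)` is identified, by the determinant pairing,
with the space of alternating `k`-linear forms on `V_x`; a section is smooth if its values on
smooth sections of `V` are smooth functions. -/
def Forms (k : ℕ) : Submodule ℝ (Π x, V x [⋀^Fin k]→ₗ[ℝ] ℝ) where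
  carrier := {η | ∀ Y : Fin k → Sec B F V,
    ContMDiff 𝓘(ℝ, B) 𝓘(ℝ, ℝ) ∞ fun x ↦ η x fun i ↦ Y i x}
  add_mem' h h' Y := (h Y).add (h' Y)
  zero_mem' _ := contMDiff_const
  smul_mem' _ _ h Y := contMDiff_const.mul (h Y)

/-- The smooth function obtained by applying a form to smooth sections. -/
def formApp {k : ℕ} (η : Forms B F V k) (Y : Fin k → Sec B F V) : C^∞⟮𝓘(ℝ, B), M; ℝ⟯ :=
  ⟨fun x ↦ η.1 x fun i ↦ Y i x, η.2 Y⟩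

theorem update_eval {k : ℕ} (x : M) (Y : Fin k → Sec B F V) (i : Fin k) (s : Sec B F V) :
    (fun j ↦ update Y i s j x) = update (fun j ↦ Y j x) i (s x) := by
  ext1 j
  by_cases h : j = i
  · subst h; simp
  · simp [h]

variable [∀ x, IsTopologicalAddGroup (V x)] [∀ x, ContinuousSMul ℝ (V x)]
  [ContMDiffVectorBundle ∞ F V 𝓘(ℝ, B)]
  (cov : CovariantDerivative 𝓘(ℝ, B) F V)
  [CovariantDerivative.ContMDiffCovariantDerivative cov ∞]

/-- The function `X (η(Y₁,…,Yₖ)) - ∑ᵢ η(Y₁,…,∇_X Yᵢ,…,Yₖ)`. -/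
def formDeriv {k : ℕ} (X : VecField B M) (η : Forms B F V k) (Y : Fin k → Sec B F V) :
    C^∞⟮𝓘(ℝ, B), M; ℝ⟯ :=
  dirDeriv X (formApp η Y) - ∑ i, formApp η (update Y i (nabla cov X (Y i)))

theorem app_update_add {k : ℕ} (η : Forms B F V k) (Y : Fin k → Sec B F V) (i : Fin k)
    (s t : Sec B F V) :
    formApp η (update Y i (s + t)) = formApp η (update Y i s) + formApp η (update Y i t) := by
  ext x
  change η.1 x _ = η.1 x _ + η.1 x _
  rw [update_eval, update_eval, update_eval]
  exact (η.1 x).map_update_add _ _ _ _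

theorem app_update_smul {k : ℕ} (η : Forms B F V k) (Y : Fin k → Sec B F V) (i : Fin k)
    (c : ℝ) (s : Sec B F V) :
    formApp η (update Y i (c • s)) = c • formApp η (update Y i s) := by
  ext x
  change η.1 x _ = c • η.1 x _
  rw [update_eval, update_eval]
  exact (η.1 x).map_update_smul _ _ _ _

theorem app_update_fmul {k : ℕ} (η : Forms B F V k) (Y : Fin k → Sec B F V) (i : Fin k)
    (f : C^∞⟮𝓘(ℝ, B), M; ℝ⟯) (s : Sec B F V) :
    formApp η (update Y i (fmul f s)) = f * formApp η (update Y i s) := by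
  ext x
  change η.1 x _ = f x • η.1 x _
  rw [update_eval, update_eval]
  exact (η.1 x).map_update_smul _ _ _ _

/-- A form as an alternating map on sections. -/
def formAlt {k : ℕ} (η : Forms B F V k) : Sec B F V [⋀^Fin k]→ₗ[ℝ] C^∞⟮𝓘(ℝ, B), M; ℝ⟯ where
  toFun := formApp η
  map_update_add' Y i s t := by
    convert! app_update_add η Y i s t
  map_update_smul' Y i c s := by
    convert! app_update_smul η Y i c s
  map_eq_zero_of_eq' Y i j h hij := by
    ext x
    exact (η.1 x).map_eq_zero_of_eq (fun i ↦ Y i x) (congrArg (fun s : Sec B F V ↦ s x) h) hij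

theorem formDeriv_update {k : ℕ} (X : VecField B M) (η : Forms B F V k) (Y : Fin k → Sec B F V)
    (i : Fin k) (s : Sec B F V) :
    formDeriv cov X η (update Y i s) = dirDeriv X (formApp η (update Y i s)) -
      (formApp η (update Y i (nabla cov X s)) + ∑ l ∈ Finset.univ.erase i,
        formApp η (update (update Y l (nabla cov X (Y l))) i s)) := by
  rw [formDeriv, ← Finset.add_sum_erase _ _ (Finset.mem_univ i)]
  congr 2
  · simp
  · refine Finset.sum_congr rfl fun l hl ↦ ?_
    have hl' : l ≠ i := Finset.ne_of_mem_erase hl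
    rw [update_of_ne hl', update_comm hl']

theorem formDeriv_update_add {k : ℕ} (X : VecField B M) (η : Forms B F V k)
    (Y : Fin k → Sec B F V) (i : Fin k) (s t : Sec B F V) :
    formDeriv cov X η (update Y i (s + t)) =
      formDeriv cov X η (update Y i s) + formDeriv cov X η (update Y i t) := by
  simp only [formDeriv_update, app_update_add, dirDeriv_add, nabla_add, Finset.sum_add_distrib]
  abel

theorem formDeriv_update_smul {k : ℕ} (X : VecField B M) (η : Forms B F V k)
    (Y : Fin k → Sec B F V) (i : Fin k) (c : ℝ) (s : Sec B F V) :
    formDeriv cov X η (update Y i (c • s)) = c • formDeriv cov X η (update Y i s) := by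
  simp only [formDeriv_update, app_update_smul, dirDeriv_smul, nabla_smul, ← Finset.smul_sum,
    smul_sub, smul_add]

theorem formDeriv_update_fmul {k : ℕ} (X : VecField B M) (η : Forms B F V k)
    (Y : Fin k → Sec B F V) (i : Fin k) (f : C^∞⟮𝓘(ℝ, B), M; ℝ⟯) (s : Sec B F V) :
    formDeriv cov X η (update Y i (fmul f s)) = f * formDeriv cov X η (update Y i s) := by
  simp only [formDeriv_update, app_update_fmul, dirDeriv_mul, nabla_fmul, app_update_add,
    ← Finset.mul_sum]
  ring

/-- `formDeriv` as an alternating map on sections. -/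
def formDerivAlt {k : ℕ} (X : VecField B M) (η : Forms B F V k) :
    Sec B F V [⋀^Fin k]→ₗ[ℝ] C^∞⟮𝓘(ℝ, B), M; ℝ⟯ where
  toFun := formDeriv cov X η
  map_update_add' Y i s t := by
    convert! formDeriv_update_add cov X η Y i s t
  map_update_smul' Y i c s := by
    convert! formDeriv_update_smul cov X η Y i c s
  map_eq_zero_of_eq' Y i j h hij := by
    have h0 : formApp η Y = 0 := (formAlt η).map_eq_zero_of_eq Y h hij
    have h1 : dirDeriv X (0 : C^∞⟮𝓘(ℝ, B), M; ℝ⟯) = 0 := by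
      simpa using dirDeriv_smul 0 X (0 : C^∞⟮𝓘(ℝ, B), M; ℝ⟯)
    rw [formDeriv, h0, h1, zero_sub, neg_eq_zero,
      ← Finset.add_sum_erase _ _ (Finset.mem_univ i),
      ← Finset.add_sum_erase _ _ (Finset.mem_erase.2 ⟨hij.symm, Finset.mem_univ j⟩),
      Finset.sum_eq_zero, add_zero]
    · have e : update Y j (nabla cov X (Y j)) =
          update Y i (nabla cov X (Y i)) ∘ Equiv.swap i j := by
        ext1 l
        by_cases hi : l = i
        · subst hi; simp [hij, hij.symm, h]
        · by_cases hj : l = j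
          · subst hj; simp [h]
          · simp [Equiv.swap_apply_of_ne_of_ne hi hj, hi, hj]
      rw [e]
      exact (formAlt η).map_add_swap _ hij
    · intro l hl
      simp only [Finset.mem_erase] at hl
      refine (formAlt η).map_eq_zero_of_eq _ ?_ hij
      rw [update_of_ne hl.2.1.symm, update_of_ne hl.1.symm, h]

section Induced

variable [FiniteDimensional ℝ B] [FiniteDimensional ℝ F] [T2Space M]

/-- Evaluation of smooth functions at a point. -/
def evalFun (x : M) : C^∞⟮𝓘(ℝ, B), M; ℝ⟯ →ₗ[ℝ] ℝ where
  toFun f := f x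
  map_add' _ _ := rfl
  map_smul' _ _ := rfl

/-- The value at `x` of the function `X (η(Y₁,…,Yₖ)) - ∑ᵢ η(Y₁,…,∇_X Yᵢ,…,Yₖ)`, as an alternating
form in the values of the sections `Yᵢ` at `x`. -/
def nablaFormAt {k : ℕ} (X : VecField B M) (η : Forms B F V k) (x : M) :
    V x [⋀^Fin k]→ₗ[ℝ] ℝ :=
  (evalFun x).compAlternatingMap ((formDerivAlt cov X η).compLinearMap (extSec x))

theorem nablaFormAt_apply {k : ℕ} (X : VecField B M) (η : Forms B F V k) (x : M)
    (Y : Fin k → Sec B F V) :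
    nablaFormAt cov X η x (fun i ↦ Y i x) = formDeriv cov X η Y x := by
  refine tensorial_congr (x := x)
    ((evalFun x).compAlternatingMap (formDerivAlt cov X η)).toMultilinearMap ?_
    (fun i ↦ extSec x (Y i x)) Y fun i ↦ by simp
  intro Y i f
  change formDeriv cov X η (update Y i (fmul f (Y i))) x = f x • formDeriv cov X η Y x
  rw [formDeriv_update_fmul, update_eq_self]
  rfl

/-- The connection induced on `∧^k(V*)`:
`(∇_X η)(Y₁,…,Yₖ) = X (η(Y₁,…,Yₖ)) - ∑ᵢ η(Y₁,…,∇_X Yᵢ,…,Yₖ)`. -/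
def nablaForm {k : ℕ} (X : VecField B M) (η : Forms B F V k) : Forms B F V k :=
  ⟨nablaFormAt cov X η, fun Y ↦ by
    simp only [nablaFormAt_apply]
    exact (formDeriv cov X η Y).contMDiff⟩

theorem formApp_nablaForm {k : ℕ} (X : VecField B M) (η : Forms B F V k) (Y : Fin k → Sec B F V) :
    formApp (nablaForm cov X η) Y = formDeriv cov X η Y := by
  ext x; exact nablaFormAt_apply cov X η x Y

theorem form_ext {k : ℕ} {η θ : Forms B F V k} (h : ∀ Y, formApp η Y = formApp θ Y) : η = θ := by
  refine Subtype.ext (funext fun x ↦ AlternatingMap.ext fun v ↦ ?_)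
  have := congrArg (fun f : C^∞⟮𝓘(ℝ, B), M; ℝ⟯ ↦ f x) (h fun i ↦ extSec x (v i))
  simpa [formApp] using this

theorem formApp_add {k : ℕ} (η θ : Forms B F V k) (Y : Fin k → Sec B F V) :
    formApp (η + θ) Y = formApp η Y + formApp θ Y := rfl

theorem formApp_smul {k : ℕ} (c : ℝ) (η : Forms B F V k) (Y : Fin k → Sec B F V) :
    formApp (c • η) Y = c • formApp η Y := rfl

variable (B F V) in
/-- Smooth sections of `∧(V*)`, by degrees; all components of degree above the rank vanish. -/
abbrev AllForms : Type _ := Π k : ℕ, Forms B F V k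

/-- The connection induced on `∧(V*)`. -/
def nablaForms : VecField B M →ₗ[ℝ] AllForms B F V →ₗ[ℝ] AllForms B F V :=
  LinearMap.mk₂ ℝ (fun X η k ↦ nablaForm cov X (η k))
    (fun X Y η ↦ funext fun k ↦ form_ext fun Z ↦ by
      simp only [Pi.add_apply, formApp_add, formApp_nablaForm, formDeriv, dirDeriv_add_left,
        nabla_add_left, app_update_add, Finset.sum_add_distrib]
      abel)
    (fun c X η ↦ funext fun k ↦ form_ext fun Z ↦ by
      simp only [Pi.smul_apply, formApp_smul, formApp_nablaForm, formDeriv, dirDeriv_smul_left,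
        nabla_smul_left, app_update_smul, ← Finset.smul_sum, smul_sub])
    (fun X η θ ↦ funext fun k ↦ form_ext fun Z ↦ by
      simp only [Pi.add_apply, formApp_add, formApp_nablaForm, formDeriv, dirDeriv_add,
        Finset.sum_add_distrib]
      abel)
    (fun c X η ↦ funext fun k ↦ form_ext fun Z ↦ by
      simp only [Pi.smul_apply, formApp_smul, formApp_nablaForm, formDeriv, dirDeriv_smul,
        ← Finset.smul_sum, smul_sub])

/-- The product of a smooth function and a smooth section of `∧(V*)`. -/
def formsMul (f : C^∞⟮𝓘(ℝ, B), M; ℝ⟯) : AllForms B F V →+ AllForms B F V where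
  toFun η k := ⟨fun x ↦ f x • (η k).1 x, fun Y ↦ f.contMDiff.mul ((η k).2 Y)⟩
  map_zero' := funext fun _ ↦ Subtype.ext (funext fun x ↦ smul_zero (f x))
  map_add' _ _ := funext fun _ ↦ Subtype.ext (funext fun x ↦ smul_add (f x) _ _)

theorem formApp_formsMul (f : C^∞⟮𝓘(ℝ, B), M; ℝ⟯) (η : AllForms B F V) (k : ℕ)
    (Y : Fin k → Sec B F V) : formApp (formsMul f η k) Y = f * formApp (η k) Y := rfl

theorem nablaForms_fmul_left (f : C^∞⟮𝓘(ℝ, B), M; ℝ⟯) (X : VecField B M) (η : AllForms B F V) :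
    nablaForms cov (fmul f X) η = formsMul f (nablaForms cov X η) := by
  refine funext fun k ↦ form_ext fun Y ↦ ?_
  rw [formApp_formsMul]
  change formApp (nablaForm cov (fmul f X) (η k)) Y = f * formApp (nablaForm cov X (η k)) Y
  simp only [formApp_nablaForm, formDeriv, nabla_fmul_left, app_update_fmul, dirDeriv_fmul_left,
    ← Finset.mul_sum]
  ring

theorem nablaForms_formsMul (f : C^∞⟮𝓘(ℝ, B), M; ℝ⟯) (X : VecField B M) (η : AllForms B F V) :
    nablaForms cov X (formsMul f η) =
      formsMul f (nablaForms cov X η) + formsMul (dirDeriv X f) η := by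
  refine funext fun k ↦ form_ext fun Y ↦ ?_
  rw [Pi.add_apply, formApp_add, formApp_formsMul, formApp_formsMul]
  change formApp (nablaForm cov X (formsMul f η k)) Y =
    f * formApp (nablaForm cov X (η k)) Y + _
  simp only [formApp_nablaForm, formDeriv, formApp_formsMul, dirDeriv_mul, ← Finset.mul_sum]
  ring

variable (B F) in
/-- The pairing of the value at `p` of a section of `∧(V*)` with an element of `∧(V_p)`, with
`η_p(v₁ ∧ ⋯ ∧ vₖ) = η_p(v₁,…,vₖ)`. -/
def pairAt (p : M) : AllForms B F V →ₗ[ℝ] ExteriorAlgebra ℝ (V p) →ₗ[ℝ] ℝ :=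
  ExteriorAlgebra.liftAlternating ∘ₗ
    LinearMap.pi fun k ↦ LinearMap.proj p ∘ₗ (Forms B F V k).subtype ∘ₗ LinearMap.proj k

end Induced

end Forms

section Phi

variable {B : Type*} [NormedAddCommGroup B] [NormedSpace ℝ B] [FiniteDimensional ℝ B]
  {M : Type*} [TopologicalSpace M] [T2Space M] [ChartedSpace B M] [IsManifold 𝓘(ℝ, B) ∞ M]
  {F : Type*} [NormedAddCommGroup F] [NormedSpace ℝ F] [FiniteDimensional ℝ F]
  {V : M → Type*} [TopologicalSpace (TotalSpace F V)]
  [∀ x, AddCommGroup (V x)] [∀ x, Module ℝ (V x)] [∀ x, TopologicalSpace (V x)]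
  [∀ x, IsTopologicalAddGroup (V x)] [∀ x, ContinuousSMul ℝ (V x)]
  [FiberBundle F V] [VectorBundle ℝ F V]
  [ContMDiffVectorBundle ∞ F V 𝓘(ℝ, B)]
  (covT : CovariantDerivative 𝓘(ℝ, B) B (TangentSpace 𝓘(ℝ, B) : M → Type _))
  [CovariantDerivative.ContMDiffCovariantDerivative covT ∞]
  (cov : CovariantDerivative 𝓘(ℝ, B) F V)
  [CovariantDerivative.ContMDiffCovariantDerivative cov ∞]

/-- The connection on `TM` as a bilinear map on smooth vector fields. -/
def nablaT : VecField B M →ₗ[ℝ] VecField B M →ₗ[ℝ] VecField B M :=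
  LinearMap.mk₂ ℝ (nabla covT) (nabla_add_left covT) (nabla_smul_left covT) (nabla_add covT)
    (fun c X Y ↦ nabla_smul covT X c Y)

/-- The higher covariant derivative `∇^j_{Y₁,…,Y_j}` on sections of `∧(V*)`. -/
abbrev higherForms (j : ℕ) :
    MultilinearMap ℝ (fun _ : Fin j ↦ VecField B M) (AllForms B F V →ₗ[ℝ] AllForms B F V) :=
  higherMul (G := AllForms B F V) (nablaT covT) (nablaForms cov) j

/-- `(v₁,…,v_j) ↦ α ↦ (η ↦ (∇^j_{ṽ₁,…,ṽ_j} η)_p(α))`, where `ṽ` is a smooth extension of `v`. -/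
def phiTerm (p : M) (j : ℕ) :
    MultilinearMap ℝ (fun _ : Fin j ↦ TangentSpace 𝓘(ℝ, B) p)
      (ExteriorAlgebra ℝ (V p) →ₗ[ℝ] Module.Dual ℝ (AllForms B F V)) :=
  (LinearMap.lflip.toLinearMap ∘ₗ LinearMap.llcomp ℝ _ _ _ (pairAt B F p)).compMultilinearMap
    ((higherForms covT cov j).compLinearMap fun _ ↦ extSec p)

/-- The map `Φ_p` from `⊗(T_pM) ⊠ ∧(V_p)` to the dual of the space of smooth sections of
`∧(V*)`. -/
def Phi (p : M) :
    TensorAlgebra ℝ (TangentSpace 𝓘(ℝ, B) p) ⊗[ℝ] ExteriorAlgebra ℝ (V p) →ₗ[ℝ]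
      Module.Dual ℝ (AllForms B F V) :=
  TensorProduct.lift
    (DirectSum.toModule ℝ ℕ _ (fun j ↦ PiTensorProduct.lift (phiTerm covT cov p j)) ∘ₗ
      (TensorAlgebra.equivDirectSum (R := ℝ)
        (M := TangentSpace 𝓘(ℝ, B) p)).toLinearMap)

/-- The defining formula of `Φ_p`, for arbitrary smooth extensions `Y` of the tangent vectors. -/
theorem Phi_apply (p : M) {j : ℕ} (v : Fin j → TangentSpace 𝓘(ℝ, B) p)
    (Y : Fin j → VecField B M) (hY : ∀ i, Y i p = v i) (α : ExteriorAlgebra ℝ (V p))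
    (η : AllForms B F V) :
    Phi covT cov p (TensorAlgebra.tprod ℝ _ j v ⊗ₜ α) η =
      pairAt B F p (higherForms covT cov j Y η) α := by
  have h1 : Phi covT cov p (TensorAlgebra.tprod ℝ _ j v ⊗ₜ α) η =
      pairAt B F p (higherForms covT cov j (fun i ↦ extSec p (v i)) η) α := by
    rw [Phi, TensorProduct.lift.tmul, LinearMap.comp_apply]
    have : (TensorAlgebra.equivDirectSum (R := ℝ) (M := TangentSpace 𝓘(ℝ, B) p)).toLinearMap
        (TensorAlgebra.tprod ℝ _ j v) =
        DirectSum.lof ℝ ℕ (fun n ↦ ⨂[ℝ]^n (TangentSpace 𝓘(ℝ, B) p)) j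
          (PiTensorProduct.tprod ℝ v) :=
      TensorAlgebra.toDirectSum_tensorPower_tprod v
    rw [this, DirectSum.toModule_lof, PiTensorProduct.lift.tprod]
    rfl
  rw [h1]
  refine tensorial_congr (x := p)
    ((LinearMap.applyₗ α ∘ₗ pairAt B F (V := V) p ∘ₗ LinearMap.applyₗ η).compMultilinearMap
      (higherForms covT cov j)) (fun Z i f ↦ ?_) (fun i ↦ extSec p (v i)) Y (fun i ↦ by simp [hY])
  · change pairAt B F p (higherForms covT cov j (update Z i (fmul f (Z i))) η) α =
      f p • pairAt B F p (higherForms covT cov j Z η) α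
    have h3 := higher_tensorial (G := AllForms B F V) (nablaT covT) (nablaForms cov) fmul formsMul
      dirDeriv (nabla_fmul_left covT) (fun f X Y ↦ nabla_fmul covT X f Y)
      (nablaForms_fmul_left cov) (nablaForms_formsMul cov) j Z i f (Z i) η
    rw [update_eq_self] at h3
    rw [h3]
    have h4 : ∀ ζ : AllForms B F V, pairAt B F p (formsMul f ζ) = f p • pairAt B F p ζ :=
      fun ζ ↦ map_smul ExteriorAlgebra.liftAlternating (f p) (fun k ↦ (ζ k).1 p)
    rw [h4]
    rfl

/-- The subspace `P ⊠ Q` of a tensor product. -/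
abbrev box {P Q : Type*} [AddCommGroup P] [Module ℝ P] [AddCommGroup Q] [Module ℝ Q]
    (S : Submodule ℝ P) (T : Submodule ℝ Q) : Submodule ℝ (P ⊗[ℝ] Q) :=
  Submodule.map₂ (TensorProduct.mk ℝ P Q) S T

/-- The tensors of order at most `r`. -/
def tensorLE (W : Type*) [AddCommGroup W] [Module ℝ W] (r : ℕ) :
    Submodule ℝ (TensorAlgebra ℝ W) :=
  ⨆ i ≤ r, LinearMap.range (TensorAlgebra.ι ℝ (M := W)) ^ i

/-- The symmetric tensors of order at most `r`. -/
def symLE (W : Type*) [AddCommGroup W] [Module ℝ W] (r : ℕ) :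
    Submodule ℝ (SymmetricAlgebra ℝ W) :=
  ⨆ i ≤ r, LinearMap.range (SymmetricAlgebra.ι ℝ W) ^ i

/-- `U_k^r(V;p)`, the image of `⊗^{≤r}(T_pM) ⊠ ∧^k(V_p)` under `Φ_p`. Functionals on sections of
`∧^k(V*)` are regarded as functionals on sections of `∧(V*)` that vanish on the other degrees. -/
def U (p : M) (r k : ℕ) : Submodule ℝ (Module.Dual ℝ (AllForms B F V)) :=
  (box (tensorLE (TangentSpace 𝓘(ℝ, B) p) r) (⋀[ℝ]^k (V p))).map (Phi covT cov p)

/-- `U(V;p)`, the sum of the spaces `U_k^r(V;p)`. -/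
def UTotal (p : M) : Submodule ℝ (Module.Dual ℝ (AllForms B F V)) :=
  ⨆ (r : ℕ) (k : ℕ), U covT cov p r k

variable (B V) in
/-- The natural projection `⊗(T_pM) ⊠ ∧(V_p) → S(T_pM) ⊠ ∧(V_p)`. -/
def toSym (p : M) :
    TensorAlgebra ℝ (TangentSpace 𝓘(ℝ, B) p) ⊗[ℝ] ExteriorAlgebra ℝ (V p) →ₗ[ℝ]
      SymmetricAlgebra ℝ (TangentSpace 𝓘(ℝ, B) p) ⊗[ℝ] ExteriorAlgebra ℝ (V p) :=
  TensorProduct.map (SymmetricAlgebra.algHom ℝ (TangentSpace 𝓘(ℝ, B) p)).toLinearMap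
    LinearMap.id

/-- `ker Φ_p` is a two-sided ideal of the algebra `⊗(T_pM) ⊠ ∧(V_p)`. -/
def KerIsIdeal (p : M) : Prop :=
  ∃ J : TwoSidedIdeal
      (TensorAlgebra ℝ (TangentSpace 𝓘(ℝ, B) p) ⊗[ℝ] ExteriorAlgebra ℝ (V p)),
    ∀ z, z ∈ J ↔ z ∈ LinearMap.ker (Phi covT cov p)

/-- `Φ_p` factors through `S(T_pM) ⊠ ∧(V_p)`. -/
def FactorsThroughSym (p : M) : Prop :=
  ∃ Ψ : SymmetricAlgebra ℝ (TangentSpace 𝓘(ℝ, B) p) ⊗[ℝ] ExteriorAlgebra ℝ (V p) →ₗ[ℝ]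
      Module.Dual ℝ (AllForms B F V),
    Phi covT cov p = Ψ ∘ₗ toSym B V p

end Phi

end CovJet

end

/-!
By the Ricci identity the commutator of two vector fields in `⊗(T_pM)` acts on forms through the
curvatures of `∧(E*)` and of `TM`. So `Φ_p` factors through `S(T_pM) ⊠ ∧(E_p)` as soon as both
curvatures vanish to all orders at `p`. Conversely, functions, as forms of degree `0`, have no
curvature when `∇̂` is torsion-free, so a factorization, tested on functions, makes every derivative
of `R^{TM}` at `p` vanish, and then, tested on forms of degree `1`, every derivative of `R^E`.

For the same reason every commutator times `1 ∈ ∧(E_p)` is in the kernel of `Φ_p`. If the kernel is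
an ideal, it contains all multiples of these elements, and `Φ_p` factors.

A map through which `Φ_p` factors is injective: if `g` is a function with `g(p) = 0` and `η` is a
form, then at `p` all derivatives of `g^r η` of order less than `r` vanish, and the one along
`v_1, …, v_r` is `r! ∏ dg(v_i) η`. So an element of the kernel has leading term zero as a
`∧(E_p)`-valued polynomial function of `dg`, and an element of `S(T_pM) ⊠ ∧(E_p)` is determined by
such a function. Hence the kernel of `Φ_p` is that of the projection to `S(T_pM) ⊠ ∧(E_p)`, which
is an ideal.
-/

noncomputable section

namespace CovJet

/-! ### Tensor algebras -/

section TensorAlgebra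

variable {R : Type*} [CommSemiring R] {X : Type*} [AddCommMonoid X] [Module R X]
  {W : Type*} [AddCommMonoid W] [Module R W]

open TensorAlgebra (ι tprod)

theorem tprod_zero (v : Fin 0 → X) : tprod R X 0 v = 1 := by
  simp only [TensorAlgebra.tprod_apply, List.ofFn_zero, List.prod_nil]

theorem tprod_succ {j : ℕ} (v : Fin (j + 1) → X) :
    tprod R X (j + 1) v = ι R (v 0) * tprod R X j (Fin.tail v) := by
  simp only [TensorAlgebra.tprod_apply, List.ofFn_succ, List.prod_cons, Fin.tail]

theorem tprod_cons {j : ℕ} (x : X) (v : Fin j → X) :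
    tprod R X (j + 1) (Fin.cons x v) = ι R x * tprod R X j v := by
  rw [tprod_succ, Fin.cons_zero, Fin.tail_cons]

variable (R X) in
theorem span_tprod_eq_top :
    Submodule.span R (Set.range fun v : Σ j, Fin j → X ↦ tprod R X v.1 v.2) = ⊤ := by
  refine eq_top_iff.2 fun t _ ↦ ?_
  rw [← TensorAlgebra.ofDirectSum_toDirectSum t]
  induction TensorAlgebra.toDirectSum t using DirectSum.induction_on with
  | zero => simp only [map_zero, zero_mem]
  | add s t hs ht => simpa only [map_add] using add_mem hs ht
  | of j u =>
    induction u using PiTensorProduct.induction_on with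
    | smul_tprod c v =>
      have hof : DirectSum.of (fun j ↦ ⨂[R]^j X) j (c • PiTensorProduct.tprod R v) =
          c • DirectSum.of (fun j ↦ ⨂[R]^j X) j (PiTensorProduct.tprod R v) :=
        map_smul (DirectSum.lof R ℕ (fun j ↦ ⨂[R]^j X) j) c _
      rw [hof, map_smul, TensorAlgebra.ofDirectSum_of_tprod]
      exact Submodule.smul_mem _ c (Submodule.subset_span ⟨⟨j, v⟩, rfl⟩)
    | add s t hs ht => simpa only [map_add] using add_mem hs ht

theorem mem_of_tprod_mem (L : TensorAlgebra R X →ₗ[R] W) {N : Submodule R W}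
    (h : ∀ (j : ℕ) (v : Fin j → X), L (tprod R X j v) ∈ N) (t : TensorAlgebra R X) : L t ∈ N := by
  have hspan : Submodule.span R (Set.range fun v : Σ j, Fin j → X ↦ tprod R X v.1 v.2) ≤
      N.comap L := Submodule.span_le.2 <| Set.range_subset_iff.2 fun v ↦ h v.1 v.2
  exact hspan (span_tprod_eq_top R X ▸ Submodule.mem_top)

theorem linearMap_ext_tprod {L L' : TensorAlgebra R X →ₗ[R] W}
    (h : ∀ (j : ℕ) (v : Fin j → X), L (tprod R X j v) = L' (tprod R X j v)) : L = L' :=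
  LinearMap.ext_on_range (span_tprod_eq_top R X) fun v ↦ h v.1 v.2

theorem linearMap_ext_ι_mul {L L' : TensorAlgebra R X →ₗ[R] W} (h_one : L 1 = L' 1)
    (h_ι_mul : ∀ x t, L t = L' t → L (ι R x * t) = L' (ι R x * t)) : L = L' := by
  refine linearMap_ext_tprod fun j v ↦ ?_
  induction j with
  | zero => rw [tprod_zero, h_one]
  | succ j ih => rw [tprod_succ, h_ι_mul _ _ (ih _)]

/-- The linear map on the tensor algebra with prescribed restrictions to the tensor powers. -/
def ofMultilinear : (Π j : ℕ, MultilinearMap R (fun _ : Fin j ↦ X) W) →ₗ[R]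
    TensorAlgebra R X →ₗ[R] W :=
  LinearMap.lcomp R W (TensorAlgebra.equivDirectSum (R := R) (M := X)).toLinearMap ∘ₗ
    (DFinsupp.lsum R).toLinearMap ∘ₗ
      LinearMap.pi fun j ↦ (PiTensorProduct.lift (R := R)).toLinearMap ∘ₗ LinearMap.proj j

@[simp]
theorem ofMultilinear_tprod (m : Π j : ℕ, MultilinearMap R (fun _ : Fin j ↦ X) W) {j : ℕ}
    (v : Fin j → X) : ofMultilinear m (tprod R X j v) = m j v := by
  have hv : (TensorAlgebra.equivDirectSum (R := R) (M := X)).toLinearMap (tprod R X j v) =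
      DFinsupp.single j (PiTensorProduct.tprod R v) :=
    TensorAlgebra.toDirectSum_tensorPower_tprod v
  change DFinsupp.lsum R _ _ = _
  rw [hv, DFinsupp.lsum_single]
  exact PiTensorProduct.lift.tprod v

/-- The algebra homomorphism to the dual numbers over the tensor algebra with `x ↦ x + ε f x` on
vectors; its infinitesimal part is the derivation `tensorDer f`. -/
def tensorDualLift (f : Module.End R X) :
    TensorAlgebra R X →ₐ[R] TrivSqZeroExt (TensorAlgebra R X) (TensorAlgebra R X) :=
  TensorAlgebra.lift R <|
    (TrivSqZeroExt.inlAlgHom R (TensorAlgebra R X) (TensorAlgebra R X)).toLinearMap ∘ₗ ι R +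
      (TrivSqZeroExt.inrHom (TensorAlgebra R X) (TensorAlgebra R X)).restrictScalars R ∘ₗ ι R ∘ₗ f

/-- The derivation of the tensor algebra that extends a linear endomorphism. -/
def tensorDer (f : Module.End R X) : Module.End R (TensorAlgebra R X) :=
  (TrivSqZeroExt.sndHom (TensorAlgebra R X) (TensorAlgebra R X)).restrictScalars R ∘ₗ
    (tensorDualLift f).toLinearMap

theorem tensorDualLift_fst (f : Module.End R X) (t : TensorAlgebra R X) :
    (tensorDualLift f t).fst = t := by
  have h : (TrivSqZeroExt.fstHom R (TensorAlgebra R X) (TensorAlgebra R X)).comp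
      (tensorDualLift f) = AlgHom.id R _ := by
    ext x
    simp [tensorDualLift]
  exact AlgHom.congr_fun h t

@[simp]
theorem tensorDer_ι (f : Module.End R X) (x : X) : tensorDer f (ι R x) = ι R (f x) := by
  simp [tensorDer, tensorDualLift]

@[simp]
theorem tensorDer_one (f : Module.End R X) : tensorDer f 1 = 0 := by
  simp [tensorDer]

theorem tensorDer_mul (f : Module.End R X) (s t : TensorAlgebra R X) :
    tensorDer f (s * t) = tensorDer f s * t + s * tensorDer f t := by
  simp [tensorDer, tensorDualLift_fst, add_comm]

theorem tensorDer_tprod (f : Module.End R X) {j : ℕ} (v : Fin j → X) :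
    tensorDer f (tprod R X j v) = ∑ k, tprod R X j (update v k (f (v k))) := by
  induction j with
  | zero => rw [tprod_zero, tensorDer_one, Finset.univ_eq_empty, Finset.sum_empty]
  | succ j ih =>
    rw [tprod_succ, tensorDer_mul, tensorDer_ι, ih, Fin.sum_univ_succ, Finset.mul_sum]
    congr 1
    · rw [tprod_succ, update_self, Fin.tail_update_zero]
    · refine Finset.sum_congr rfl fun k _ ↦ ?_
      rw [tprod_succ, Fin.tail_update_succ, update_of_ne (Fin.succ_ne_zero k).symm, Fin.tail]

theorem eq_tensorDer {f : Module.End R X} {D : Module.End R (TensorAlgebra R X)}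
    (h_one : D 1 = 0) (h_ι_mul : ∀ x t, D (ι R x * t) = ι R (f x) * t + ι R x * D t) :
    D = tensorDer f := by
  refine linearMap_ext_ι_mul (by rw [h_one, tensorDer_one]) fun x t ht ↦ ?_
  rw [h_ι_mul, ht, tensorDer_mul, tensorDer_ι]

end TensorAlgebra

section TensorAlgebraRing

variable {R : Type*} [CommRing R] {X : Type*} [AddCommGroup X] [Module R X]

open TensorAlgebra (ι)

theorem tensorDer_sub (f g : Module.End R X) :
    tensorDer (f - g) = tensorDer f - tensorDer g := by
  refine (eq_tensorDer (by simp) fun x t ↦ ?_).symm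
  simp only [LinearMap.sub_apply, tensorDer_mul, tensorDer_ι, map_sub, sub_mul, mul_sub]
  abel

theorem tensorDer_lie (f g : Module.End R X) : tensorDer ⁅f, g⁆ = ⁅tensorDer f, tensorDer g⁆ := by
  refine (eq_tensorDer (by simp [Ring.lie_def]) fun x t ↦ ?_).symm
  simp only [Ring.lie_def, LinearMap.sub_apply, Module.End.mul_apply, tensorDer_mul, tensorDer_ι,
    map_add, map_sub, sub_mul, mul_sub]
  abel

variable (R X) in
/-- The right ideal of the tensor algebra generated by the commutators of vectors, on which a left
factor of `⊗(T_pM)` acts through covariant differentiation. -/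
def commutatorSpan : Submodule R (TensorAlgebra R X) :=
  Submodule.span R {t | ∃ (a b : X) (w : TensorAlgebra R X), t = ⁅ι R a, ι R b⁆ * w}

theorem commutator_mul_mem (a b : X) (w : TensorAlgebra R X) :
    ⁅ι R a, ι R b⁆ * w ∈ commutatorSpan R X :=
  Submodule.subset_span ⟨a, b, w, rfl⟩

theorem commutatorSpan_le_comap {W : Type*} [AddCommGroup W] [Module R W]
    (L : TensorAlgebra R X →ₗ[R] W) {N : Submodule R W} :
    commutatorSpan R X ≤ N.comap L ↔
      ∀ (a b : X) (w : TensorAlgebra R X), L (⁅ι R a, ι R b⁆ * w) ∈ N := by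
  refine ⟨fun h a b w ↦ h (commutator_mul_mem a b w), fun h ↦ Submodule.span_le.2 ?_⟩
  rintro - ⟨a, b, w, rfl⟩
  exact h a b w

theorem commutatorSpan_le_comap_tensorDer (f : Module.End R X) :
    commutatorSpan R X ≤ (commutatorSpan R X).comap (tensorDer f) := by
  refine (commutatorSpan_le_comap (tensorDer f)).2 fun a b w ↦ ?_
  have leibniz : tensorDer f (⁅ι R a, ι R b⁆ * w) =
      ⁅ι R (f a), ι R b⁆ * w + ⁅ι R a, ι R (f b)⁆ * w + ⁅ι R a, ι R b⁆ * tensorDer f w := by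
    simp only [Ring.lie_def, tensorDer_mul, map_sub, tensorDer_ι, sub_mul, add_mul]
    abel
  rw [leibniz]
  exact add_mem (add_mem (commutator_mul_mem _ _ _) (commutator_mul_mem _ _ _))
    (commutator_mul_mem _ _ _)

theorem eq_zero_of_symmetricAlgebra_algHom_eq_zero {W : Type*} [AddCommMonoid W] [Module R W]
    {L : TensorAlgebra R X →ₗ[R] W}
    (hL : ∀ (v : TensorAlgebra R X) (a b : X) (w : TensorAlgebra R X),
      L (v * ⁅ι R a, ι R b⁆ * w) = 0)
    {t : TensorAlgebra R X} (ht : SymmetricAlgebra.algHom R X t = 0) : L t = 0 := by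
  let J : TwoSidedIdeal (TensorAlgebra R X) := TwoSidedIdeal.mk' {x | ∀ y z, L (y * x * z) = 0}
    (fun y z ↦ by rw [mul_zero, zero_mul, map_zero])
    (fun {s t} hs ht y z ↦ by rw [mul_add, add_mul, map_add, hs y z, ht y z, add_zero])
    (fun {s} hs y z ↦ by rw [← neg_one_smul R s, mul_smul_comm, smul_mul_assoc, map_smul, hs y z,
      smul_zero])
    (fun {s t} ht y z ↦ by rw [← mul_assoc]; exact ht (y * s) z)
    (fun {s t} hs y z ↦ by rw [← mul_assoc, mul_assoc]; exact hs y (t * z))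
  have mem_J {x} : x ∈ J ↔ ∀ y z, L (y * x * z) = 0 := TwoSidedIdeal.mem_mk' _ _ _ _ _ _ _
  have hle : TensorAlgebra.symRingCon R X ≤ J.ringCon := by
    refine RingCon.ringConGen_le.2 ?_
    rintro _ _ ⟨a, b⟩
    exact (TwoSidedIdeal.rel_iff J _ _).2 (mem_J.2 fun y z ↦ hL y a b z)
  have ht' : TensorAlgebra.symRingCon R X t 0 := (RingCon.eq _).1 ht
  simpa using mem_J.1 ((TwoSidedIdeal.mem_iff J t).2 (hle ht')) 1 1

end TensorAlgebraRing

/-! ### Higher covariant derivatives and the Ricci identity -/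

section HigherTensor

variable {X : Type*} [AddCommGroup X] [Module ℝ X] {G : Type*} [AddCommGroup G] [Module ℝ G]
  (nT : X →ₗ[ℝ] Module.End ℝ X) (n : X →ₗ[ℝ] Module.End ℝ G)

open TensorAlgebra (ι tprod)

/-- The higher covariant derivatives as a linear map on the tensor algebra of vector fields. -/
def higherTensor : TensorAlgebra ℝ X →ₗ[ℝ] Module.End ℝ G :=
  ofMultilinear fun j ↦ higherMul nT n j

@[simp]
theorem higherTensor_tprod {j : ℕ} (v : Fin j → X) :
    higherTensor nT n (tprod ℝ X j v) = higherMul nT n j v :=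
  ofMultilinear_tprod _ _

@[simp]
theorem higherTensor_one : higherTensor nT n 1 = 1 := by
  rw [← tprod_zero (R := ℝ) (Fin.elim0 : Fin 0 → X), higherTensor_tprod]
  rfl

theorem higherTensor_ι_mul (x : X) (t : TensorAlgebra ℝ X) :
    higherTensor nT n (ι ℝ x * t) =
      n x * higherTensor nT n t - higherTensor nT n (tensorDer (nT x) t) := by
  suffices h : higherTensor nT n ∘ₗ LinearMap.mulLeft ℝ (ι ℝ x) =
      LinearMap.mulLeft ℝ (n x) ∘ₗ higherTensor nT n - higherTensor nT n ∘ₗ tensorDer (nT x) from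
    LinearMap.congr_fun h t
  refine linearMap_ext_tprod fun j v ↦ ?_
  change higherTensor nT n (ι ℝ x * tprod ℝ X j v) = n x * higherTensor nT n (tprod ℝ X j v) -
    higherTensor nT n (tensorDer (nT x) (tprod ℝ X j v))
  rw [← tprod_cons, tensorDer_tprod, map_sum]
  simp only [higherTensor_tprod]
  ext s
  rw [LinearMap.sub_apply, LinearMap.sum_apply]
  rfl

theorem higherTensor_ι (x : X) : higherTensor nT n (ι ℝ x) = n x := by
  simpa using higherTensor_ι_mul nT n x 1

end HigherTensor

section Curvature

variable {R : Type*} [CommRing R] {X : Type*} [AddCommGroup X] [Module R X]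
  {G : Type*} [AddCommGroup G] [Module R G]

/-- The curvature `[∇_a, ∇_b] - ∇_{∇_a b - ∇_b a}` of the connection `n`, where the torsion-free
connection `nT` on vector fields stands in for the Lie bracket. -/
def curvEnd (nT : X → Module.End R X) (n : X → Module.End R G) (a b : X) : Module.End R G :=
  ⁅n a, n b⁆ - n (nT a b - nT b a)

theorem tensorDer_curvEnd {nT : X → Module.End R X} (n : X →ₗ[R] Module.End R G) (a b : X) :
    tensorDer (curvEnd nT n a b) = curvEnd nT (fun x ↦ tensorDer (n x)) a b := by
  rw [curvEnd, tensorDer_sub, tensorDer_lie, curvEnd]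

theorem apply_curvEnd_apply_of_leibniz {nT : X → Module.End R X} {n : X → Module.End R G}
    {S : Type*} [AddCommGroup S] [Module R S] {A : Type*} [AddCommGroup A] [Module R A]
    {n' : X → Module.End R S} {d : X → Module.End R A} (P : G →ₗ[R] S →ₗ[R] A)
    (hP : ∀ x s t, P (n x s) t = d x (P s t) - P s (n' x t)) (a b : X) (s : G) (t : S) :
    P (curvEnd nT n a b s) t = curvEnd nT d a b (P s t) - P s (curvEnd nT n' a b t) := by
  simp only [curvEnd, Ring.lie_def, LinearMap.sub_apply, Module.End.mul_apply, map_sub, hP]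
  abel

end Curvature

section Ricci

variable {X : Type*} [AddCommGroup X] [Module ℝ X] {G : Type*} [AddCommGroup G] [Module ℝ G]
  (nT : X →ₗ[ℝ] Module.End ℝ X) (n : X →ₗ[ℝ] Module.End ℝ G)

open TensorAlgebra (ι)

theorem higherTensor_commutator_mul (a b : X) (w : TensorAlgebra ℝ X) :
    higherTensor nT n (⁅ι ℝ a, ι ℝ b⁆ * w) =
      curvEnd nT n a b * higherTensor nT n w -
        higherTensor nT n (tensorDer (curvEnd nT nT a b) w) := by
  rw [curvEnd, curvEnd, tensorDer_sub, tensorDer_lie, map_sub nT, tensorDer_sub]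
  simp only [Ring.lie_def, sub_mul, mul_assoc, higherTensor_ι_mul, map_sub, map_add, tensorDer_mul,
    tensorDer_ι, LinearMap.sub_apply, Module.End.mul_apply, mul_sub]
  abel

theorem higherTensor_commutator (a b : X) :
    higherTensor nT n ⁅ι ℝ a, ι ℝ b⁆ = curvEnd nT n a b := by
  simpa using higherTensor_commutator_mul nT n a b 1

end Ricci

/-! ### Vanishing to a given order -/

theorem apply_mem_of_mem_closure_range {G G' : Type*} [AddGroup G] [AddCommGroup G'] {κ : Type*}
    {T : κ → G →+ G'} {N : AddSubgroup G'} {C : G →+ G'}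
    (hC : C ∈ AddSubgroup.closure (Set.range T)) {s : G} (h : ∀ i, T i s ∈ N) : C s ∈ N := by
  have hle : AddSubgroup.closure (Set.range T) ≤ N.comap (AddMonoidHom.eval s) :=
    (AddSubgroup.closure_le _).2 <| Set.range_subset_iff.2 h
  exact hle hC

section Vanishing

variable {R : Type*} [Ring R] {X : Type*} {G : Type*} [AddCommGroup G] [Module R G]

/-- The elements of `G` that vanish to order `k`: they and all their iterated derivatives of order
less than `k` lie in `Z`, the space of the elements that vanish. -/
def vanish (n : X → Module.End R G) (Z : Submodule R G) : ℕ → Submodule R G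
  | 0 => ⊤
  | k + 1 => Z ⊓ ⨅ x, (vanish n Z k).comap (n x)

variable {n : X → Module.End R G} {Z : Submodule R G}

theorem mem_vanish_zero (s : G) : s ∈ vanish n Z 0 := Submodule.mem_top

theorem mem_vanish_succ {k : ℕ} {s : G} :
    s ∈ vanish n Z (k + 1) ↔ s ∈ Z ∧ ∀ x, n x s ∈ vanish n Z k := by
  simp only [vanish, Submodule.mem_inf, Submodule.mem_iInf, Submodule.mem_comap]

theorem vanish_succ_le (k : ℕ) : vanish n Z (k + 1) ≤ vanish n Z k := by
  induction k with
  | zero => exact fun s _ ↦ mem_vanish_zero s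
  | succ k ih =>
    intro s hs
    rw [mem_vanish_succ] at hs ⊢
    exact ⟨hs.1, fun x ↦ ih (hs.2 x)⟩

theorem vanish_succ_le_zeros (k : ℕ) : vanish n Z (k + 1) ≤ Z := fun _ hs ↦ (mem_vanish_succ.1 hs).1

section Map

variable {G' : Type*} [AddCommGroup G'] [Module R G'] {n' : X → Module.End R G'}
  {Z' : Submodule R G'} {κ : Type*} {T : κ → G →+ G'}

theorem map_mem_vanish
    (hcomm : ∀ i x, (n' x : G' →+ G').comp (T i) - (T i).comp (n x) ∈
      AddSubgroup.closure (Set.range T))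
    (hZ : ∀ i, ∀ s ∈ Z, T i s ∈ Z') {k : ℕ} {s : G} (hs : s ∈ vanish n Z k) (i : κ) :
    T i s ∈ vanish n' Z' k := by
  induction k generalizing s i with
  | zero => exact mem_vanish_zero _
  | succ k ih =>
    obtain ⟨hs0, hs1⟩ := mem_vanish_succ.1 hs
    refine mem_vanish_succ.2 ⟨hZ i s hs0, fun x ↦ ?_⟩
    have comm_mem : n' x (T i s) - T i (n x s) ∈ (vanish n' Z' k).toAddSubgroup :=
      apply_mem_of_mem_closure_range (hcomm i x) fun i ↦ ih (vanish_succ_le k hs) i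
    simpa using add_mem comm_mem (ih (hs1 x) i)

theorem mem_vanish_of_forall_map_mem {k : ℕ} {s : G}
    (hcomm : ∀ {j s}, s ∈ vanish n Z j → ∀ i x, n' x (T i s) - T i (n x s) ∈ vanish n' Z' j)
    (hZ : ∀ {s}, (∀ i, T i s ∈ Z') → s ∈ Z) (hs : ∀ i, T i s ∈ vanish n' Z' k) :
    s ∈ vanish n Z k := by
  induction k generalizing s with
  | zero => exact mem_vanish_zero _
  | succ k ih =>
    have s_mem : s ∈ vanish n Z k := ih fun i ↦ vanish_succ_le k (hs i)
    refine mem_vanish_succ.2 ⟨hZ fun i ↦ (mem_vanish_succ.1 (hs i)).1, fun x ↦ ih fun i ↦ ?_⟩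
    simpa using sub_mem ((mem_vanish_succ.1 (hs i)).2 x) (hcomm s_mem i x)

theorem mem_vanish_iff_forall_map_mem {k : ℕ} {s : G}
    (hcomm : ∀ i x, (n' x : G' →+ G').comp (T i) - (T i).comp (n x) ∈
      AddSubgroup.closure (Set.range T))
    (hZ : ∀ {s}, s ∈ Z ↔ ∀ i, T i s ∈ Z') :
    s ∈ vanish n Z k ↔ ∀ i, T i s ∈ vanish n' Z' k := by
  have map_mem {j s} (hs : s ∈ vanish n Z j) (i : κ) : T i s ∈ vanish n' Z' j :=
    map_mem_vanish hcomm (fun i s hs ↦ hZ.1 hs i) hs i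
  exact ⟨map_mem, mem_vanish_of_forall_map_mem (fun {j s} hs i x ↦
    apply_mem_of_mem_closure_range (N := (vanish n' Z' j).toAddSubgroup) (hcomm i x)
      (map_mem hs)) hZ.2⟩

end Map

theorem forall_higher_mem_iff [AddCommGroup X] (nT : X → X → X) (s : G) :
    (∀ j Y, higher nT (fun x t ↦ n x t) j Y s ∈ Z) ↔ ∀ k, s ∈ vanish n Z k := by
  constructor
  · intro h k
    suffices H : ∀ j Y, higher nT (fun x t ↦ n x t) j Y s ∈ vanish n Z k from H 0 Fin.elim0
    induction k with
    | zero => exact fun _ _ ↦ mem_vanish_zero _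
    | succ k ih =>
      refine fun j Y ↦ mem_vanish_succ.2 ⟨h j Y, fun x ↦ ?_⟩
      have deriv_eq : n x (higher nT (fun x t ↦ n x t) j Y s) =
          higher nT (fun x t ↦ n x t) (j + 1) (Fin.cons x Y) s +
            ∑ i, higher nT (fun x t ↦ n x t) j (update Y i (nT x (Y i))) s := by
        simp [higher]
      rw [deriv_eq]
      exact add_mem (ih _ _) (sum_mem fun i _ ↦ ih _ _)
  · intro h j
    suffices H : ∀ j k Y, higher nT (fun x t ↦ n x t) j Y s ∈ vanish n Z k from
      fun Y ↦ vanish_succ_le_zeros 0 (H j 1 Y)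
    intro j
    induction j with
    | zero => exact fun k _ ↦ h k
    | succ j ih =>
      exact fun k _ ↦ sub_mem ((mem_vanish_succ.1 (ih (k + 1) _)).2 _) (sum_mem fun i _ ↦ ih k _)

end Vanishing

section HigherTensorVanishing

variable {X : Type*} [AddCommGroup X] [Module ℝ X] {G : Type*} [AddCommGroup G] [Module ℝ G]
  {nT : X →ₗ[ℝ] Module.End ℝ X} {n : X →ₗ[ℝ] Module.End ℝ G} {Z : Submodule ℝ G}
  {S : Submodule ℝ (TensorAlgebra ℝ X)}

open TensorAlgebra (ι)

theorem higherTensor_mul_mem_vanish (hS : ∀ x, S ≤ S.comap (tensorDer (nT x))) {s : G}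
    (h : ∀ v, ∀ t ∈ S, higherTensor nT n (v * t) s ∈ Z) (k : ℕ) (v : TensorAlgebra ℝ X) :
    ∀ t ∈ S, higherTensor nT n (v * t) s ∈ vanish n Z k := by
  induction k generalizing v with
  | zero => exact fun t _ ↦ mem_vanish_zero _
  | succ k ih =>
    refine fun t ht ↦ mem_vanish_succ.2 ⟨h v t ht, fun x ↦ ?_⟩
    have deriv_eq : n x (higherTensor nT n (v * t) s) = higherTensor nT n (ι ℝ x * v * t) s +
        (higherTensor nT n (tensorDer (nT x) v * t) s +
          higherTensor nT n (v * tensorDer (nT x) t) s) := by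
      rw [mul_assoc, higherTensor_ι_mul, tensorDer_mul, map_add]
      simp
    rw [deriv_eq]
    exact add_mem (ih _ _ ht) (add_mem (ih _ _ ht) (ih _ _ (hS x ht)))

theorem higherTensor_mul_mem_vanish_of_mem_vanish (hS : ∀ x, S ≤ S.comap (tensorDer (nT x)))
    {s : G} (h : ∀ k, ∀ t ∈ S, higherTensor nT n t s ∈ vanish n Z k) (v : TensorAlgebra ℝ X)
    (k : ℕ) {t : TensorAlgebra ℝ X} (ht : t ∈ S) :
    higherTensor nT n (v * t) s ∈ vanish n Z k := by
  refine mem_of_tprod_mem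
    (LinearMap.applyₗ s ∘ₗ higherTensor nT n ∘ₗ (LinearMap.mul ℝ _).flip t) (fun j v ↦ ?_) v
  change higherTensor nT n (TensorAlgebra.tprod ℝ X j v * t) s ∈ vanish n Z k
  induction j generalizing k t with
  | zero => simpa only [tprod_zero, one_mul] using h k t ht
  | succ j ih =>
    rw [tprod_succ, mul_assoc, higherTensor_ι_mul, tensorDer_mul, tensorDer_tprod, map_add,
      Finset.sum_mul, map_sum, LinearMap.sub_apply, LinearMap.add_apply, LinearMap.sum_apply]
    exact sub_mem ((mem_vanish_succ.1 (ih (k + 1) ht _)).2 _)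
      (add_mem (sum_mem fun i _ ↦ ih k ht _) (ih k (hS _ ht) _))

theorem higherTensor_commutator_mem_iff (s : G) :
    (∀ (v : TensorAlgebra ℝ X) (a b : X) (w : TensorAlgebra ℝ X),
        higherTensor nT n (v * ⁅ι ℝ a, ι ℝ b⁆ * w) s ∈ Z) ↔
      ∀ (k : ℕ) (a b : X) (w : TensorAlgebra ℝ X),
        higherTensor nT n (⁅ι ℝ a, ι ℝ b⁆ * w) s ∈ vanish n Z k := by
  have hS : ∀ x, commutatorSpan ℝ X ≤ (commutatorSpan ℝ X).comap (tensorDer (nT x)) := fun x ↦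
    commutatorSpan_le_comap_tensorDer (nT x)
  constructor
  · intro h k a b w
    have mem_Z (v : TensorAlgebra ℝ X) : commutatorSpan ℝ X ≤
        Z.comap (LinearMap.applyₗ s ∘ₗ higherTensor nT n ∘ₗ LinearMap.mulLeft ℝ v) :=
      (commutatorSpan_le_comap _).2 fun a b w ↦ by simpa [mul_assoc] using h v a b w
    simpa using higherTensor_mul_mem_vanish hS (fun v t ht ↦ mem_Z v ht) k 1 _
      (commutator_mul_mem a b w)
  · intro h v a b w
    rw [mul_assoc]
    have mem_vanish (k : ℕ) : commutatorSpan ℝ X ≤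
        (vanish n Z k).comap (LinearMap.applyₗ s ∘ₗ higherTensor nT n) :=
      (commutatorSpan_le_comap _).2 fun a b w ↦ h k a b w
    exact vanish_succ_le_zeros 0 <| higherTensor_mul_mem_vanish_of_mem_vanish hS
      (fun k t ht ↦ mem_vanish k ht) v 1 (commutator_mul_mem a b w)

end HigherTensorVanishing

/-! ### Functions, sections and forms that vanish to a given order -/

section Connections

variable {B : Type*} [NormedAddCommGroup B] [NormedSpace ℝ B]
  {M : Type*} [TopologicalSpace M] [ChartedSpace B M] [IsManifold 𝓘(ℝ, B) ∞ M]
  {F : Type*} [NormedAddCommGroup F] [NormedSpace ℝ F]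
  {V : M → Type*} [TopologicalSpace (TotalSpace F V)]
  [∀ x, AddCommGroup (V x)] [∀ x, Module ℝ (V x)] [∀ x, TopologicalSpace (V x)]
  [FiberBundle F V] [VectorBundle ℝ F V]

variable (B M) in
/-- The derivative of smooth functions along smooth vector fields as a bilinear map. -/
def dirDerivLin : VecField B M →ₗ[ℝ] Module.End ℝ C^∞⟮𝓘(ℝ, B), M; ℝ⟯ :=
  LinearMap.mk₂ ℝ dirDeriv dirDeriv_add_left dirDeriv_smul_left dirDeriv_add
    fun c X f ↦ dirDeriv_smul c X f

@[simp]
theorem dirDerivLin_apply (X : VecField B M) (f : C^∞⟮𝓘(ℝ, B), M; ℝ⟯) :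
    dirDerivLin B M X f = dirDeriv X f := rfl

variable (B) in
/-- The smooth functions that vanish to order `k` at `p`. -/
abbrev funVanish (p : M) : ℕ → Submodule ℝ C^∞⟮𝓘(ℝ, B), M; ℝ⟯ :=
  vanish (dirDerivLin B M) (LinearMap.ker (evalFun p))

/-- The family `n` of operators on the `ℝ`-space `G` is a connection for the multiplication `m` by
smooth functions, and `e` is the evaluation at `p`. It allows functions, sections and forms to be
treated alike. -/
structure IsConnectionAt {G W : Type*} [AddCommGroup G] [Module ℝ G] [AddCommGroup W]
    [Module ℝ W] (p : M) (e : G →ₗ[ℝ] W) (m : C^∞⟮𝓘(ℝ, B), M; ℝ⟯ → G →+ G)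
    (n : VecField B M → Module.End ℝ G) : Prop where
  eval_mul : ∀ f s, e (m f s) = f p • e s
  leibniz : ∀ f X s, n X (m f s) = m f (n X s) + m (dirDeriv X f) s

theorem isConnectionAt_dirDerivLin (p : M) :
    IsConnectionAt p (evalFun p) AddMonoidHom.mulLeft (dirDerivLin B M) where
  eval_mul _ _ := rfl
  leibniz f X s := dirDeriv_mul X f s

variable [∀ x, IsTopologicalAddGroup (V x)] [∀ x, ContinuousSMul ℝ (V x)]
  [ContMDiffVectorBundle ∞ F V 𝓘(ℝ, B)]
  (cov : CovariantDerivative 𝓘(ℝ, B) F V)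
  [CovariantDerivative.ContMDiffCovariantDerivative cov ∞]

/-- A connection as a bilinear map on smooth vector fields and smooth sections. -/
def nablaSec : VecField B M →ₗ[ℝ] Module.End ℝ (Sec B F V) :=
  LinearMap.mk₂ ℝ (nabla cov) (nabla_add_left cov) (nabla_smul_left cov) (nabla_add cov)
    fun c X s ↦ nabla_smul cov X c s

@[simp]
theorem nablaSec_apply (X : VecField B M) (s : Sec B F V) :
    nablaSec cov X s = nabla cov X s := rfl

/-- The smooth sections that vanish to order `k` at `p`. -/
abbrev secVanish (p : M) : ℕ → Submodule ℝ (Sec B F V) :=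
  vanish (nablaSec cov) (LinearMap.ker (evalAt B F p))

end Connections

section Tensorial

variable {B : Type*} [NormedAddCommGroup B] [NormedSpace ℝ B] [FiniteDimensional ℝ B]
  {M : Type*} [TopologicalSpace M] [T2Space M] [ChartedSpace B M] [IsManifold 𝓘(ℝ, B) ∞ M]
  {F : Type*} [NormedAddCommGroup F] [NormedSpace ℝ F] [FiniteDimensional ℝ F]
  {V : M → Type*} [TopologicalSpace (TotalSpace F V)]
  [∀ x, AddCommGroup (V x)] [∀ x, Module ℝ (V x)] [∀ x, TopologicalSpace (V x)]
  [∀ x, IsTopologicalAddGroup (V x)] [∀ x, ContinuousSMul ℝ (V x)]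
  [FiberBundle F V] [VectorBundle ℝ F V]
  [ContMDiffVectorBundle ∞ F V 𝓘(ℝ, B)]
  (cov : CovariantDerivative 𝓘(ℝ, B) F V)
  [CovariantDerivative.ContMDiffCovariantDerivative cov ∞]

theorem IsConnectionAt.mem_vanish_of_tensorial {G W : Type*} [AddCommGroup G] [Module ℝ G]
    [AddCommGroup W] [Module ℝ W] {p : M} {e : G →ₗ[ℝ] W} {m : C^∞⟮𝓘(ℝ, B), M; ℝ⟯ → G →+ G}
    {n : VecField B M → Module.End ℝ G} (hn : IsConnectionAt p e m n) (T : Sec B F V →ₗ[ℝ] G)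
    (hT : ∀ f s, T (fmul f s) = m f (T s)) {k : ℕ} {s : Sec B F V}
    (hs : s ∈ secVanish cov p k) : T s ∈ vanish n (LinearMap.ker e) k := by
  let tensorial : {T : Sec B F V →ₗ[ℝ] G // ∀ f s, T (fmul f s) = m f (T s)} → Sec B F V →+ G :=
    fun T ↦ T.1
  refine map_mem_vanish (T := tensorial) (fun T X ↦ AddSubgroup.subset_closure ?_)
    (fun T s hs ↦ ?_) hs ⟨T, hT⟩
  · refine ⟨⟨n X ∘ₗ T.1 - T.1 ∘ₗ nablaSec cov X, fun f s ↦ ?_⟩, rfl⟩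
    simp only [LinearMap.sub_apply, LinearMap.comp_apply, nablaSec_apply, nabla_fmul, T.2,
      hn.leibniz, map_add, map_sub]
    abel
  · exact tensorial_zero (e ∘ₗ T.1) (fun f s ↦ by simp [T.2, hn.eval_mul]) s hs

/-- The smooth sections of `∧(V*)` that vanish to order `k` at `p`. -/
abbrev formsVanish (p : M) : ℕ → Submodule ℝ (AllForms B F V) :=
  vanish (G := AllForms B F V) (nablaForms cov) (LinearMap.ker (pairAt B F p))

theorem isConnectionAt_nablaForms (p : M) :
    IsConnectionAt (G := AllForms B F V) p (pairAt B F p) formsMul (nablaForms cov) where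
  eval_mul f η :=
    map_smul ExteriorAlgebra.liftAlternating (f p) fun k ↦ (η k).1 p
  leibniz f X η := nablaForms_formsMul cov f X η

end Tensorial

/-! ### Asymptotic flatness and torsion -/

section Curvature

variable {B : Type*} [NormedAddCommGroup B] [NormedSpace ℝ B]
  {M : Type*} [TopologicalSpace M] [ChartedSpace B M] [IsManifold 𝓘(ℝ, B) ∞ M]
  {F : Type*} [NormedAddCommGroup F] [NormedSpace ℝ F]
  {V : M → Type*} [TopologicalSpace (TotalSpace F V)]
  [∀ x, AddCommGroup (V x)] [∀ x, Module ℝ (V x)] [∀ x, TopologicalSpace (V x)]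
  [∀ x, IsTopologicalAddGroup (V x)] [∀ x, ContinuousSMul ℝ (V x)]
  [FiberBundle F V] [VectorBundle ℝ F V]
  [ContMDiffVectorBundle ∞ F V 𝓘(ℝ, B)]
  (covT : CovariantDerivative 𝓘(ℝ, B) B (TangentSpace 𝓘(ℝ, B) : M → Type _))
  [CovariantDerivative.ContMDiffCovariantDerivative covT ∞]
  (cov : CovariantDerivative 𝓘(ℝ, B) F V)
  [CovariantDerivative.ContMDiffCovariantDerivative cov ∞]

theorem curvEnd_nablaSec_apply (a b : VecField B M) (s : Sec B F V) :
    curvEnd (nablaSec covT) (nablaSec cov) a b s = curv covT cov a b s := by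
  have higher_two (a b : VecField B M) : higher (nabla covT) (nabla cov) 2 ![a, b] s =
      nabla cov a (nabla cov b s) - nabla cov (nabla covT a b) s := by
    simp [higher, Fin.tail, update]
  rw [curv, higher_two, higher_two, curvEnd, Ring.lie_def]
  simp only [LinearMap.sub_apply, Module.End.mul_apply, nablaSec_apply, map_sub]
  abel

/-- The connection on `Hom(TM ⊗ TM ⊗ V, V)` as a linear map in the section. -/
def nablaHomLin (X : VecField B M) :
    Module.End ℝ (VecField B M → VecField B M → Sec B F V → Sec B F V) where
  toFun := nablaHom covT cov X
  map_add' S T := by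
    funext a b s
    simp only [nablaHom, Pi.add_apply, nabla_add]
    abel
  map_smul' c T := by
    funext a b s
    simp only [nablaHom, Pi.smul_apply, nabla_smul, RingHom.id_apply, smul_sub]

variable (B F V) in
/-- The operations on two vector fields and a section whose values vanish at `p`. -/
def homZeros (p : M) :
    Submodule ℝ (VecField B M → VecField B M → Sec B F V → Sec B F V) where
  carrier := {T | ∀ a b s, T a b s p = 0}
  add_mem' hS hT a b s := (congrArg₂ (· + ·) (hS a b s) (hT a b s)).trans (add_zero _)
  zero_mem' _ _ _ := rfl
  smul_mem' c _ hT a b s := (congrArg (c • ·) (hT a b s)).trans (smul_zero c)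

theorem mem_vanish_nablaHomLin {p : M} {k : ℕ}
    {T : VecField B M → VecField B M → Sec B F V → Sec B F V} :
    T ∈ vanish (nablaHomLin covT cov) (homZeros B F V p) k ↔
      ∀ a b s, T a b s ∈ secVanish cov p k := by
  let eval : VecField B M × VecField B M × Sec B F V →
      (VecField B M → VecField B M → Sec B F V → Sec B F V) →+ Sec B F V := fun y ↦
    { toFun := fun T ↦ T y.1 y.2.1 y.2.2
      map_zero' := rfl
      map_add' := fun _ _ ↦ rfl }
  have eval_mem (y) : eval y ∈ AddSubgroup.closure (Set.range eval) :=
    AddSubgroup.subset_closure ⟨y, rfl⟩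
  refine (mem_vanish_iff_forall_map_mem (T := eval) (n' := nablaSec cov)
    (Z' := LinearMap.ker (evalAt B F p)) (fun ⟨a, b, s⟩ X ↦ ?_) ?_).trans ?_
  · have comm_eq : (nablaSec cov X : Sec B F V →+ Sec B F V).comp (eval ⟨a, b, s⟩) -
        (eval ⟨a, b, s⟩).comp (nablaHomLin covT cov X) =
        eval ⟨nabla covT X a, b, s⟩ + eval ⟨a, nabla covT X b, s⟩ + eval ⟨a, b, nabla cov X s⟩ := by
      ext T : 1
      change nabla cov X (T a b s) - nablaHom covT cov X T a b s =
        T (nabla covT X a) b s + T a (nabla covT X b) s + T a b (nabla cov X s)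
      rw [nablaHom]
      abel
    rw [comm_eq]
    exact add_mem (add_mem (eval_mem _) (eval_mem _)) (eval_mem _)
  · exact ⟨fun h y ↦ h y.1 y.2.1 y.2.2, fun h a b s ↦ h ⟨a, b, s⟩⟩
  · exact ⟨fun h a b s ↦ h ⟨a, b, s⟩, fun h y ↦ h y.1 y.2.1 y.2.2⟩

theorem asympFlat_iff {p : M} :
    AsympFlat covT cov p ↔
      ∀ k a b s, curvEnd (nablaSec covT) (nablaSec cov) a b s ∈ secVanish cov p k := by
  simp only [curvEnd_nablaSec_apply]
  refine Iff.trans ?_ ((forall_higher_mem_iff (n := nablaHomLin covT cov) (Z := homZeros B F V p)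
    (nabla covT) (curv covT cov)).trans (forall_congr' fun k ↦ mem_vanish_nablaHomLin covT cov))
  rfl

end Curvature

section Torsion

variable {B : Type*} [NormedAddCommGroup B] [NormedSpace ℝ B]
  {M : Type*} [TopologicalSpace M] [ChartedSpace B M] [IsManifold 𝓘(ℝ, B) ∞ M]
  (covT : CovariantDerivative 𝓘(ℝ, B) B (TangentSpace 𝓘(ℝ, B) : M → Type _))
  [CovariantDerivative.ContMDiffCovariantDerivative covT ∞]

/-- The commutator `∇_a b - ∇_b a`, which is the Lie bracket if `covT` is torsion-free. -/
def bracket (a b : VecField B M) : VecField B M := nabla covT a b - nabla covT b a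

theorem bracket_add (a b c : VecField B M) :
    bracket covT a (b + c) = bracket covT a b + bracket covT a c := by
  simp only [bracket, nabla_add, nabla_add_left]
  abel

theorem bracket_fmul (a b : VecField B M) (f : C^∞⟮𝓘(ℝ, B), M; ℝ⟯) :
    bracket covT a (fmul f b) = fmul f (bracket covT a b) + fmul (dirDeriv a f) b := by
  rw [bracket, nabla_fmul, nabla_fmul_left, bracket]
  ext x
  change f x • nabla covT a b x + dirDeriv a f x • b x - f x • nabla covT b a x =
    f x • (nabla covT a b x - nabla covT b a x) + dirDeriv a f x • b x
  rw [smul_sub]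
  abel

variable {covT} [FiniteDimensional ℝ B]

theorem mlieBracket_eq_bracket (htorsion : covT.torsion = 0)
    (a b : VecField B M) : VectorField.mlieBracket 𝓘(ℝ, B) a b = ⇑(bracket covT a b) := by
  funext x
  exact (covT.torsion_eq_zero_iff.1 htorsion (sec_mdiff a x) (sec_mdiff b x)).symm

theorem bracket_jacobi (htorsion : covT.torsion = 0) (a b c : VecField B M) :
    bracket covT a (bracket covT b c) =
      bracket covT (bracket covT a b) c + bracket covT b (bracket covT a c) := by
  have : CompleteSpace B := FiniteDimensional.complete ℝ B
  have isManifold_three : IsManifold 𝓘(ℝ, B) (minSmoothness ℝ 3) M :=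
    IsManifold.of_le (n := ∞) (by
      rw [minSmoothness_of_isRCLikeNormedField]
      exact WithTop.coe_le_coe.2 (le_top : (3 : ℕ∞) ≤ ⊤))
  have contMDiff_two (a : VecField B M) :
      ContMDiff 𝓘(ℝ, B) (𝓘(ℝ, B).prod 𝓘(ℝ, B)) (minSmoothness ℝ 2)
        (fun x ↦ TotalSpace.mk' B x (a x)) :=
    a.contMDiff.of_le (by
      rw [minSmoothness_of_isRCLikeNormedField]
      exact WithTop.coe_le_coe.2 (le_top : (2 : ℕ∞) ≤ ⊤))
  have leibniz := VectorField.leibniz_identity_mlieBracket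
    (contMDiff_two a) (contMDiff_two b) (contMDiff_two c)
  simp only [mlieBracket_eq_bracket htorsion] at leibniz
  ext x
  exact congrFun leibniz x

end Torsion

section TorsionFree

variable {B : Type*} [NormedAddCommGroup B] [NormedSpace ℝ B] [FiniteDimensional ℝ B]
  {M : Type*} [TopologicalSpace M] [T2Space M] [ChartedSpace B M] [IsManifold 𝓘(ℝ, B) ∞ M]
  {covT : CovariantDerivative 𝓘(ℝ, B) B (TangentSpace 𝓘(ℝ, B) : M → Type _)}
  [CovariantDerivative.ContMDiffCovariantDerivative covT ∞]

/-- The Jacobi identity for `a, b, fc` minus `f` times the one for `a, b, c` leaves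
`([a, b] f - a (b f) + b (a f)) c = 0`. -/
theorem curvEnd_dirDerivLin (htorsion : covT.torsion = 0) (a b : VecField B M) :
    curvEnd (nablaSec covT) (dirDerivLin B M) a b = 0 := by
  ext f x
  change dirDeriv a (dirDeriv b f) x - dirDeriv b (dirDeriv a f) x -
    dirDeriv (bracket covT a b) f x = 0
  rcases subsingleton_or_nontrivial (TangentSpace 𝓘(ℝ, B) x) with _ | _
  · have dirDeriv_eq_zero (X : VecField B M) (g : C^∞⟮𝓘(ℝ, B), M; ℝ⟯) : dirDeriv X g x = 0 :=
      (congrArg (mvfderiv 𝓘(ℝ, B) g x) (Subsingleton.elim (X x) 0)).trans (map_zero _)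
    simp only [dirDeriv_eq_zero, sub_zero]
  · obtain ⟨v, hv⟩ := exists_ne (0 : TangentSpace 𝓘(ℝ, B) x)
    let c : VecField B M := extSec x v
    have jacobi := congrArg (evalAt B B x) (bracket_jacobi htorsion a b c)
    have jacobi_fmul := congrArg (evalAt B B x) (bracket_jacobi htorsion a b (fmul f c))
    have evalAt_fmul (g : C^∞⟮𝓘(ℝ, B), M; ℝ⟯) (X : VecField B M) :
      evalAt B B x (fmul g X) = g x • evalAt B B x X := rfl
    simp only [bracket_fmul, bracket_add, map_add, evalAt_fmul] at jacobi jacobi_fmul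
    have smul_eq_zero : (dirDeriv a (dirDeriv b f) x - dirDeriv b (dirDeriv a f) x -
        dirDeriv (bracket covT a b) f x) • evalAt B B x c = 0 := by
      linear_combination (norm := module) jacobi_fmul - f x • jacobi
    rw [show evalAt B B x c = v from extSec_apply_self x v] at smul_eq_zero
    exact (_root_.smul_eq_zero.1 smul_eq_zero).resolve_right hv

end TorsionFree

/-! ### Forms as functions on tensors of sections -/

section FormTensor

variable {B : Type*} [NormedAddCommGroup B] [NormedSpace ℝ B]
  {M : Type*} [TopologicalSpace M] [ChartedSpace B M] [IsManifold 𝓘(ℝ, B) ∞ M]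
  {F : Type*} [NormedAddCommGroup F] [NormedSpace ℝ F]
  {V : M → Type*} [TopologicalSpace (TotalSpace F V)]
  [∀ x, AddCommGroup (V x)] [∀ x, Module ℝ (V x)] [∀ x, TopologicalSpace (V x)]
  [∀ x, IsTopologicalAddGroup (V x)] [∀ x, ContinuousSMul ℝ (V x)]
  [FiberBundle F V] [VectorBundle ℝ F V]
  [ContMDiffVectorBundle ∞ F V 𝓘(ℝ, B)]

open TensorAlgebra (ι tprod)

variable (B F V) in
/-- Evaluation of a section of `∧(V*)` on tensors of smooth sections of `V`. -/
def formTensor :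
    AllForms B F V →ₗ[ℝ] TensorAlgebra ℝ (Sec B F V) →ₗ[ℝ] C^∞⟮𝓘(ℝ, B), M; ℝ⟯ :=
  ofMultilinear ∘ₗ
    { toFun := fun η j ↦ (formAlt (η j)).toMultilinearMap
      map_add' := fun _ _ ↦ rfl
      map_smul' := fun _ _ ↦ rfl }

theorem formTensor_tprod (η : AllForms B F V) {j : ℕ} (Y : Fin j → Sec B F V) :
    formTensor B F V η (tprod ℝ _ j Y) = formApp (η j) Y :=
  ofMultilinear_tprod _ _

theorem formTensor_ι (η : AllForms B F V) (s : Sec B F V) :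
    formTensor B F V η (ι ℝ s) = formApp (η 1) fun _ ↦ s := by
  rw [← formTensor_tprod, tprod_succ, tprod_zero, mul_one]

theorem formTensor_one (η : AllForms B F V) : formTensor B F V η 1 = formApp (η 0) 0 := by
  rw [← formTensor_tprod, tprod_zero]

variable (F V) in
/-- A smooth function as a form of degree zero. -/
def zeroForm (f : C^∞⟮𝓘(ℝ, B), M; ℝ⟯) : AllForms B F V :=
  Pi.single 0 ⟨fun x ↦ AlternatingMap.constOfIsEmpty ℝ (V x) (Fin 0) (f x), fun _ ↦ f.contMDiff⟩

theorem formTensor_zeroForm_one (f : C^∞⟮𝓘(ℝ, B), M; ℝ⟯) :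
    formTensor B F V (zeroForm F V f) 1 = f := by
  rw [formTensor_one, zeroForm, Pi.single_eq_same]
  rfl

theorem pairAt_one (p : M) (η : AllForms B F V) :
    pairAt B F p η 1 = formTensor B F V η 1 p := by
  rw [formTensor_one]
  refine (ExteriorAlgebra.liftAlternating_one fun k ↦ (η k).1 p).trans ?_
  exact congrArg ((η 0).1 p) (Subsingleton.elim _ _)

end FormTensor

section FormTensorConnection

variable {B : Type*} [NormedAddCommGroup B] [NormedSpace ℝ B] [FiniteDimensional ℝ B]
  {M : Type*} [TopologicalSpace M] [T2Space M] [ChartedSpace B M] [IsManifold 𝓘(ℝ, B) ∞ M]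
  {F : Type*} [NormedAddCommGroup F] [NormedSpace ℝ F] [FiniteDimensional ℝ F]
  {V : M → Type*} [TopologicalSpace (TotalSpace F V)]
  [∀ x, AddCommGroup (V x)] [∀ x, Module ℝ (V x)] [∀ x, TopologicalSpace (V x)]
  [∀ x, IsTopologicalAddGroup (V x)] [∀ x, ContinuousSMul ℝ (V x)]
  [FiberBundle F V] [VectorBundle ℝ F V]
  [ContMDiffVectorBundle ∞ F V 𝓘(ℝ, B)]
  (covT : CovariantDerivative 𝓘(ℝ, B) B (TangentSpace 𝓘(ℝ, B) : M → Type _))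
  [CovariantDerivative.ContMDiffCovariantDerivative covT ∞]
  (cov : CovariantDerivative 𝓘(ℝ, B) F V)
  [CovariantDerivative.ContMDiffCovariantDerivative cov ∞]

open TensorAlgebra (ι tprod)

theorem formTensor_nablaForms (X : VecField B M) (η : AllForms B F V)
    (t : TensorAlgebra ℝ (Sec B F V)) :
    formTensor B F V (nablaForms cov X η) t =
      dirDerivLin B M X (formTensor B F V η t) -
        formTensor B F V η (tensorDer (nablaSec cov X) t) := by
  suffices h : formTensor B F V (nablaForms cov X η) =
      dirDerivLin B M X ∘ₗ formTensor B F V η -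
        formTensor B F V η ∘ₗ tensorDer (nablaSec cov X) from LinearMap.congr_fun h t
  refine linearMap_ext_tprod fun j Y ↦ ?_
  simp only [LinearMap.sub_apply, LinearMap.comp_apply, tensorDer_tprod, map_sum, formTensor_tprod]
  exact formApp_nablaForm cov X (η j) Y

theorem pairAt_eq_zero_iff {p : M} {η : AllForms B F V} :
    pairAt B F p η = 0 ↔ ∀ t, formTensor B F V η t p = 0 := by
  have pairAt_eq_zero : pairAt B F p η = 0 ↔ ∀ j, (η j).1 p = 0 := by
    change ExteriorAlgebra.liftAlternatingEquiv (fun j ↦ (η j).1 p) = 0 ↔ _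
    rw [LinearEquiv.map_eq_zero_iff]
    exact funext_iff
  rw [pairAt_eq_zero]
  constructor
  · intro h
    refine LinearMap.congr_fun (f := evalFun p ∘ₗ formTensor B F V η) (g := 0)
      (linearMap_ext_tprod fun j Y ↦ ?_)
    change formTensor B F V η (tprod ℝ _ j Y) p = 0
    rw [formTensor_tprod]
    exact DFunLike.congr_fun (h j) _
  · refine fun h j ↦ AlternatingMap.ext fun v ↦ ?_
    have eval_eq_zero := h (tprod ℝ _ j fun i ↦ extSec p (v i))
    rw [formTensor_tprod] at eval_eq_zero
    simpa [formApp] using eval_eq_zero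

theorem mem_formsVanish_iff {p : M} {k : ℕ} {η : AllForms B F V} :
    η ∈ formsVanish cov p k ↔ ∀ t, formTensor B F V η t ∈ funVanish B p k := by
  let eval : TensorAlgebra ℝ (Sec B F V) → AllForms B F V →+ C^∞⟮𝓘(ℝ, B), M; ℝ⟯ :=
    fun t ↦ ((formTensor B F V).flip t : _ →ₗ[ℝ] _)
  have mem_ker_iff {η : AllForms B F V} : η ∈ LinearMap.ker (pairAt B F p) ↔
      ∀ t, eval t η ∈ LinearMap.ker (evalFun p) := pairAt_eq_zero_iff
  refine mem_vanish_iff_forall_map_mem (G := AllForms B F V) (fun t X ↦ ?_) mem_ker_iff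
  refine AddSubgroup.subset_closure ⟨tensorDer (nablaSec cov X) t, AddMonoidHom.ext fun η ↦ ?_⟩
  change formTensor B F V η (tensorDer (nablaSec cov X) t) =
    dirDerivLin B M X (formTensor B F V η t) - formTensor B F V (nablaForms cov X η) t
  rw [formTensor_nablaForms, sub_sub_cancel]

variable {covT} in
theorem formTensor_curvEnd (hT : ∀ a b, curvEnd (nablaSec covT) (dirDerivLin B M) a b = 0)
    (a b : VecField B M) (η : AllForms B F V) (t : TensorAlgebra ℝ (Sec B F V)) :
    formTensor B F V (curvEnd (nablaSec covT) (nablaForms cov) a b η) t =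
      -formTensor B F V η (tensorDer (curvEnd (nablaSec covT) (nablaSec cov) a b) t) := by
  refine (apply_curvEnd_apply_of_leibniz (G := AllForms B F V) (formTensor B F V)
    (formTensor_nablaForms cov) a b η t).trans ?_
  rw [hT, LinearMap.zero_apply, zero_sub, tensorDer_curvEnd]

end FormTensorConnection

/-! ### Forms and functions with prescribed values and differentials at a point -/

section FormExistence

variable {B : Type*} [NormedAddCommGroup B] [NormedSpace ℝ B] [FiniteDimensional ℝ B]
  {M : Type*} [TopologicalSpace M] [T2Space M] [ChartedSpace B M] [IsManifold 𝓘(ℝ, B) ∞ M]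
  {F : Type*} [NormedAddCommGroup F] [NormedSpace ℝ F] [FiniteDimensional ℝ F]
  {V : M → Type*} [TopologicalSpace (TotalSpace F V)]
  [∀ x, AddCommGroup (V x)] [∀ x, Module ℝ (V x)] [∀ x, TopologicalSpace (V x)]
  [FiberBundle F V] [VectorBundle ℝ F V]
  [ContMDiffVectorBundle ∞ F V 𝓘(ℝ, B)]

variable (B F V) in
theorem exists_covectors_sum_smul_eq (p : M) :
    ∃ (θ : Fin (Module.finrank ℝ F) → Π x, V x →ₗ[ℝ] ℝ) (b : Fin (Module.finrank ℝ F) → V p),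
      (∀ i (s : Sec B F V), ContMDiff 𝓘(ℝ, B) 𝓘(ℝ, ℝ) ∞ fun x ↦ θ i x (s x)) ∧
        ∀ v, ∑ i, θ i p v • b i = v := by
  have : ContMDiffVectorBundle 1 F V 𝓘(ℝ, B) := ContMDiffVectorBundle.of_le (n := ∞) (by simp)
  let t := trivializationAt F V p
  let b := Module.finBasis ℝ F
  have hp : p ∈ t.baseSet := FiberBundle.mem_baseSet_trivializationAt F V p
  obtain ⟨ρ, -, hρ⟩ := (SmoothBumpFunction.nhds_basis_tsupport (I := 𝓘(ℝ, B)) p).mem_iff.1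
    (t.open_baseSet.mem_nhds hp)
  refine ⟨fun i x ↦ ρ x • t.localFrameCoeff 𝓘(ℝ, B) b i x, fun i ↦ t.localFrame b i p,
    fun i s ↦ contMDiff_of_tsupport fun y hy ↦ ?_, fun v ↦ ?_⟩
  · have hy : y ∈ t.baseSet := hρ (tsupport_mul_subset_left hy)
    exact ρ.contMDiff.contMDiffAt.mul <| (contMDiffOn_baseSet_localFrameCoeff (e := t) b (k := ∞)
      s.contMDiff.contMDiffOn i y hy).contMDiffAt (t.open_baseSet.mem_nhds hy)
  · obtain ⟨s, rfl⟩ := evalAt_surjective (B := B) (F := F) p v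
    simp only [ρ.eq_one, one_smul]
    exact (t.eq_sum_localFrameCoeff_smul (I := 𝓘(ℝ, B)) (b := b) (s := s) hp).symm

theorem exists_forms_eq (p : M) {k : ℕ} (A : V p [⋀^Fin k]→ₗ[ℝ] ℝ) :
    ∃ η : Forms B F V k, η.1 p = A := by
  obtain ⟨θ, b, θ_smooth, sum_smul_eq⟩ := exists_covectors_sum_smul_eq B F V p
  let L (x : M) : V x →ₗ[ℝ] V p := ∑ i, (θ i x).smulRight (b i)
  have L_apply (x) (v : V x) : L x v = ∑ i, θ i x v • b i := by simp [L, LinearMap.sum_apply]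
  refine ⟨⟨fun x ↦ A.compLinearMap (L x), fun Y ↦ ?_⟩, ?_⟩
  · have apply_eq_sum : (fun x ↦ A.compLinearMap (L x) fun i ↦ Y i x) = fun x ↦
        ∑ r : Fin k → Fin (Module.finrank ℝ F), (∏ j, θ (r j) x (Y j x)) * A fun j ↦ b (r j) := by
      funext x
      simp only [AlternatingMap.compLinearMap_apply, L_apply]
      refine (A.toMultilinearMap.map_sum _).trans (Finset.sum_congr rfl fun r _ ↦ ?_)
      exact A.toMultilinearMap.map_smul_univ _ _
    rw [apply_eq_sum]
    exact contMDiff_finsetSum fun r _ ↦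
      (contMDiff_finsetProd fun j _ ↦ θ_smooth (r j) (Y j)).mul contMDiff_const
  · ext v
    simp only [AlternatingMap.compLinearMap_apply, L_apply, sum_smul_eq]

theorem exists_pairAt_eq (p : M) (φ : ExteriorAlgebra ℝ (V p) →ₗ[ℝ] ℝ) :
    ∃ η : AllForms B F V, pairAt B F p η = φ := by
  choose η hη using fun k ↦ exists_forms_eq (B := B) (F := F) p
    (ExteriorAlgebra.liftAlternatingEquiv.symm φ k)
  refine ⟨η, ?_⟩
  change ExteriorAlgebra.liftAlternatingEquiv (fun k ↦ (η k).1 p) = φ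
  rw [funext hη]
  exact LinearEquiv.apply_symm_apply _ _

end FormExistence

section FunctionExistence

variable {B : Type*} [NormedAddCommGroup B] [NormedSpace ℝ B] [FiniteDimensional ℝ B]
  {M : Type*} [TopologicalSpace M] [T2Space M] [ChartedSpace B M] [IsManifold 𝓘(ℝ, B) ∞ M]

theorem exists_dirDeriv_eq (p : M) (ℓ : TangentSpace 𝓘(ℝ, B) p →ₗ[ℝ] ℝ) :
    ∃ g : C^∞⟮𝓘(ℝ, B), M; ℝ⟯, g p = 0 ∧ ∀ X : VecField B M, dirDeriv X g p = ℓ (X p) := by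
  obtain ⟨D, hD⟩ := isInvertible_mfderiv_extChartAt (I := 𝓘(ℝ, B))
    (mem_extChartAt_source (I := 𝓘(ℝ, B)) p)
  obtain ⟨ρ⟩ : Nonempty (SmoothBumpFunction 𝓘(ℝ, B) p) := inferInstance
  let ℓ' : B →L[ℝ] ℝ := LinearMap.toContinuousLinearMap (E := B)
    (ℓ ∘ₗ (D.symm.toLinearEquiv.toLinearMap : B →ₗ[ℝ] B))
  let c : B := extChartAt 𝓘(ℝ, B) p p
  let u : B → ℝ := fun y ↦ ℓ' (y - c)
  have u_smooth : ContMDiff 𝓘(ℝ, B) 𝓘(ℝ, ℝ) ∞ u :=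
    (ℓ'.contDiff.comp (contDiff_id.sub contDiff_const)).contMDiff
  have mvfderiv_u : mvfderiv 𝓘(ℝ, B) u c = ℓ' := by
    change mfderiv 𝓘(ℝ, B) 𝓘(ℝ, ℝ) u c = ℓ'
    rw [mfderiv_eq_fderiv]
    exact (ℓ'.hasFDerivAt.comp c ((hasFDerivAt_id c).sub_const c)).fderiv
  refine ⟨⟨fun x ↦ ρ x • u (extChartAt 𝓘(ℝ, B) p x),
    ρ.contMDiff_smul (u_smooth.comp_contMDiffOn contMDiffOn_extChartAt)⟩, ?_, fun X ↦ ?_⟩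
  · change ρ p • ℓ' (c - c) = 0
    rw [sub_self, map_zero, smul_zero]
  · have eventuallyEq_comp :
        (fun x ↦ ρ x • u (extChartAt 𝓘(ℝ, B) p x)) =ᶠ[𝓝 p] u ∘ extChartAt 𝓘(ℝ, B) p := by
      filter_upwards [ρ.eventuallyEq_one] with x hx
      rw [hx, Pi.one_apply, one_smul, comp_apply]
    have mvfderiv_eq : mvfderiv 𝓘(ℝ, B) (fun x ↦ ρ x • u (extChartAt 𝓘(ℝ, B) p x)) p =
        mvfderiv 𝓘(ℝ, B) (u ∘ extChartAt 𝓘(ℝ, B) p) p := eventuallyEq_comp.mfderiv_eq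
    calc mvfderiv 𝓘(ℝ, B) (fun x ↦ ρ x • u (extChartAt 𝓘(ℝ, B) p x)) p (X p)
      _ = mvfderiv 𝓘(ℝ, B) (u ∘ extChartAt 𝓘(ℝ, B) p) p (X p) := by rw [mvfderiv_eq]
      _ = ℓ' (D (X p)) := by
        rw [mvfderiv_comp_apply p (u_smooth.mdifferentiable (by simp) _)
          (mdifferentiableAt_extChartAt (mem_chart_source _ p)), ← hD, mvfderiv_u]
        rfl
      _ = ℓ (X p) := congrArg ℓ (D.symm_apply_apply (X p))

end FunctionExistence

section DetectVanishing

variable {B : Type*} [NormedAddCommGroup B] [NormedSpace ℝ B] [FiniteDimensional ℝ B]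
  {M : Type*} [TopologicalSpace M] [T2Space M] [ChartedSpace B M] [IsManifold 𝓘(ℝ, B) ∞ M]
  {F : Type*} [NormedAddCommGroup F] [NormedSpace ℝ F] [FiniteDimensional ℝ F]
  {V : M → Type*} [TopologicalSpace (TotalSpace F V)]
  [∀ x, AddCommGroup (V x)] [∀ x, Module ℝ (V x)] [∀ x, TopologicalSpace (V x)]
  [∀ x, IsTopologicalAddGroup (V x)] [∀ x, ContinuousSMul ℝ (V x)]
  [FiberBundle F V] [VectorBundle ℝ F V]
  [ContMDiffVectorBundle ∞ F V 𝓘(ℝ, B)]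
  (covT : CovariantDerivative 𝓘(ℝ, B) B (TangentSpace 𝓘(ℝ, B) : M → Type _))
  [CovariantDerivative.ContMDiffCovariantDerivative covT ∞]
  (cov : CovariantDerivative 𝓘(ℝ, B) F V)
  [CovariantDerivative.ContMDiffCovariantDerivative cov ∞]

open TensorAlgebra (ι)

theorem mem_secVanish_iff_forall_formTensor {p : M} {k : ℕ} {s : Sec B F V} :
    s ∈ secVanish cov p k ↔ ∀ η, formTensor B F V η (ι ℝ s) ∈ funVanish B p k := by
  let pair (η : AllForms B F V) : Sec B F V →+ C^∞⟮𝓘(ℝ, B), M; ℝ⟯ :=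
    (formTensor B F V η ∘ₗ ι ℝ : _ →ₗ[ℝ] _)
  refine mem_vanish_iff_forall_map_mem (T := pair)
    (fun η X ↦ AddSubgroup.subset_closure ⟨nablaForms cov X η, AddMonoidHom.ext fun s ↦ ?_⟩)
    (fun {s} ↦ ⟨fun hs η ↦ ?_, fun h ↦ ?_⟩)
  · change formTensor B F V (nablaForms cov X η) (ι ℝ s) =
      dirDerivLin B M X (formTensor B F V η (ι ℝ s)) - formTensor B F V η (ι ℝ (nablaSec cov X s))
    rw [formTensor_nablaForms, tensorDer_ι]
  · change formTensor B F V η (ι ℝ s) p = 0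
    rw [formTensor_ι]
    exact (η 1).1 p |>.map_coord_zero 0 hs
  · refine (Module.forall_dual_apply_eq_zero_iff ℝ _).1 fun φ ↦ ?_
    obtain ⟨η, hη⟩ := exists_forms_eq (B := B) (F := F) p
      (AlternatingMap.ofSubsingleton ℝ (V p) ℝ (0 : Fin 1) φ)
    have pair_eq_zero : formTensor B F V (Pi.single 1 η) (ι ℝ s) p = 0 := h (Pi.single 1 η)
    rw [formTensor_ι, Pi.single_eq_same] at pair_eq_zero
    change η.1 p (fun _ ↦ s p) = 0 at pair_eq_zero
    rwa [hη] at pair_eq_zero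

theorem mem_secVanish_of_forall_dirDeriv {p : M} {k : ℕ} {Z : VecField B M}
    (h : ∀ f, dirDeriv Z f ∈ funVanish B p k) : Z ∈ secVanish covT p k := by
  refine mem_vanish_of_forall_map_mem
    (T := fun f ↦ ((dirDerivLin B M).flip f : VecField B M →+ C^∞⟮𝓘(ℝ, B), M; ℝ⟯))
    (fun {j Z} hZ f X ↦ ?_) (fun {Z} hZ ↦ ?_) h
  · refine (isConnectionAt_dirDerivLin p).mem_vanish_of_tensorial covT
      (dirDerivLin B M X ∘ₗ (dirDerivLin B M).flip f -
        (dirDerivLin B M).flip f ∘ₗ nablaSec covT X) (fun g Y ↦ ?_) hZ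
    simp only [LinearMap.sub_apply, LinearMap.comp_apply, LinearMap.flip_apply, dirDerivLin_apply,
      nablaSec_apply, dirDeriv_fmul_left, nabla_fmul, dirDeriv_add_left, dirDeriv_mul,
      AddMonoidHom.coe_mulLeft]
    ring
  · refine (Module.forall_dual_apply_eq_zero_iff ℝ _).1 fun φ ↦ ?_
    obtain ⟨g, -, hg⟩ := exists_dirDeriv_eq p φ
    exact (hg Z).symm.trans (hZ g)

end DetectVanishing

/-! ### Factorization through the symmetric algebra and flatness -/

section EvTensor

variable {B : Type*} [NormedAddCommGroup B] [NormedSpace ℝ B]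
  {M : Type*} [TopologicalSpace M] [ChartedSpace B M] [IsManifold 𝓘(ℝ, B) ∞ M]

open TensorAlgebra (ι tprod)

variable (B) in
/-- Evaluation at a point of tensors in smooth vector fields. -/
def evTensor (p : M) :
    TensorAlgebra ℝ (VecField B M) →ₐ[ℝ] TensorAlgebra ℝ (TangentSpace 𝓘(ℝ, B) p) :=
  TensorAlgebra.lift ℝ (ι ℝ ∘ₗ evalAt B B p)

theorem evTensor_ι (p : M) (X : VecField B M) : evTensor B p (ι ℝ X) = ι ℝ (X p) :=
  TensorAlgebra.lift_ι_apply _ _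

theorem evTensor_lie (p : M) (a b : VecField B M) :
    evTensor B p ⁅ι ℝ a, ι ℝ b⁆ = ⁅ι ℝ (a p), ι ℝ (b p)⁆ := by
  simp only [Ring.lie_def, map_sub, map_mul, evTensor_ι]

theorem evTensor_tprod (p : M) {j : ℕ} (Y : Fin j → VecField B M) :
    evTensor B p (tprod ℝ _ j Y) = tprod ℝ _ j fun i ↦ Y i p := by
  simp only [TensorAlgebra.tprod_apply, map_list_prod, List.map_ofFn, comp_def, evTensor_ι]

theorem evTensor_surjective [FiniteDimensional ℝ B] [T2Space M] (p : M) :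
    Surjective (evTensor B p) := by
  rw [← AlgHom.range_eq_top, evTensor, TensorAlgebra.range_lift, LinearMap.coe_comp,
    (evalAt_surjective p).range_comp, TensorAlgebra.adjoin_range_ι]

end EvTensor

section Flatness

variable {B : Type*} [NormedAddCommGroup B] [NormedSpace ℝ B] [FiniteDimensional ℝ B]
  {M : Type*} [TopologicalSpace M] [T2Space M] [ChartedSpace B M] [IsManifold 𝓘(ℝ, B) ∞ M]
  {F : Type*} [NormedAddCommGroup F] [NormedSpace ℝ F] [FiniteDimensional ℝ F]
  {V : M → Type*} [TopologicalSpace (TotalSpace F V)]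
  [∀ x, AddCommGroup (V x)] [∀ x, Module ℝ (V x)] [∀ x, TopologicalSpace (V x)]
  [∀ x, IsTopologicalAddGroup (V x)] [∀ x, ContinuousSMul ℝ (V x)]
  [FiberBundle F V] [VectorBundle ℝ F V]
  [ContMDiffVectorBundle ∞ F V 𝓘(ℝ, B)]
  (covT : CovariantDerivative 𝓘(ℝ, B) B (TangentSpace 𝓘(ℝ, B) : M → Type _))
  [CovariantDerivative.ContMDiffCovariantDerivative covT ∞]
  (cov : CovariantDerivative 𝓘(ℝ, B) F V)
  [CovariantDerivative.ContMDiffCovariantDerivative cov ∞]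

open TensorAlgebra (ι tprod)

/-- The higher covariant derivatives on sections of `∧(V*)`, with the vector fields collected in
the tensor algebra. -/
abbrev formsTensor : TensorAlgebra ℝ (VecField B M) →ₗ[ℝ] Module.End ℝ (AllForms B F V) :=
  higherTensor (G := AllForms B F V) (nablaSec covT) (nablaForms cov)

theorem Phi_evTensor (p : M) (τ : TensorAlgebra ℝ (VecField B M)) (α : ExteriorAlgebra ℝ (V p))
    (η : AllForms B F V) :
    Phi covT cov p (evTensor B p τ ⊗ₜ α) η = pairAt B F p (formsTensor covT cov τ η) α := by
  suffices h : LinearMap.applyₗ η ∘ₗ LinearMap.applyₗ α ∘ₗ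
      TensorProduct.curry (Phi covT cov p) ∘ₗ (evTensor B p).toLinearMap =
        LinearMap.applyₗ α ∘ₗ pairAt B F p ∘ₗ LinearMap.applyₗ η ∘ₗ formsTensor covT cov from
    LinearMap.congr_fun h τ
  refine linearMap_ext_tprod fun j Y ↦ ?_
  change Phi covT cov p (evTensor B p (tprod ℝ _ j Y) ⊗ₜ α) η =
    pairAt B F p (formsTensor covT cov (tprod ℝ _ j Y) η) α
  rw [evTensor_tprod, Phi_apply covT cov p _ Y (fun _ ↦ rfl), higherTensor_tprod]
  rfl

theorem factorsThroughSym_iff {p : M} :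
    FactorsThroughSym covT cov p ↔ ∀ (y : TensorAlgebra ℝ (TangentSpace 𝓘(ℝ, B) p))
      (a b : TangentSpace 𝓘(ℝ, B) p) (z : TensorAlgebra ℝ (TangentSpace 𝓘(ℝ, B) p))
      (α : ExteriorAlgebra ℝ (V p)), Phi covT cov p ((y * ⁅ι ℝ a, ι ℝ b⁆ * z) ⊗ₜ α) = 0 := by
  let sym := SymmetricAlgebra.algHom ℝ (TangentSpace 𝓘(ℝ, B) p)
  constructor
  · rintro ⟨Ψ, hΨ⟩ y a b z α
    have sym_eq_zero : sym (y * ⁅ι ℝ a, ι ℝ b⁆ * z) = 0 := by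
      rw [Ring.lie_def, map_mul, map_mul, map_sub, map_mul, map_mul, mul_comm (sym (ι ℝ a)),
        sub_self, mul_zero, zero_mul]
    calc Phi covT cov p ((y * ⁅ι ℝ a, ι ℝ b⁆ * z) ⊗ₜ α)
      _ = Ψ (sym (y * ⁅ι ℝ a, ι ℝ b⁆ * z) ⊗ₜ α) := LinearMap.congr_fun hΨ _
      _ = 0 := by rw [sym_eq_zero, TensorProduct.zero_tmul, map_zero]
  · intro h
    obtain ⟨σ, hσ⟩ := sym.toLinearMap.exists_rightInverse_of_surjective
      (LinearMap.range_eq_top.2 (SymmetricAlgebra.algHom_surjective ℝ _))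
    refine ⟨TensorProduct.lift (TensorProduct.curry (Phi covT cov p) ∘ₗ σ),
      TensorProduct.ext' fun t α ↦ ?_⟩
    have sym_sub_eq_zero : sym (t - σ (sym t)) = 0 := by
      rw [map_sub, sub_eq_zero]
      exact (LinearMap.congr_fun hσ (sym t)).symm
    have curry_eq_zero (y a b z) :
        TensorProduct.curry (Phi covT cov p) (y * ⁅ι ℝ a, ι ℝ b⁆ * z) = 0 :=
      LinearMap.ext (h y a b z)
    have curry_sub_eq_zero :=
      eq_zero_of_symmetricAlgebra_algHom_eq_zero curry_eq_zero sym_sub_eq_zero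
    have curry_eq : TensorProduct.curry (Phi covT cov p) t =
        TensorProduct.curry (Phi covT cov p) (σ (sym t)) := by
      conv_lhs => rw [← sub_add_cancel t (σ (sym t)), map_add, curry_sub_eq_zero, zero_add]
    exact LinearMap.congr_fun curry_eq α

theorem factorsThroughSym_iff_mem_ker_pairAt {p : M} :
    FactorsThroughSym covT cov p ↔
      ∀ (η : AllForms B F V) (v : TensorAlgebra ℝ (VecField B M)) (a b : VecField B M)
        (w : TensorAlgebra ℝ (VecField B M)),
        formsTensor covT cov (v * ⁅ι ℝ a, ι ℝ b⁆ * w) η ∈ LinearMap.ker (pairAt B F p) := by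
  rw [factorsThroughSym_iff]
  constructor
  · refine fun h η v a b w ↦ LinearMap.mem_ker.2 (LinearMap.ext fun α ↦ ?_)
    rw [← Phi_evTensor, map_mul, map_mul, evTensor_lie, h]
    rfl
  · intro h y a b z α
    obtain ⟨v, rfl⟩ := evTensor_surjective p y
    obtain ⟨w, rfl⟩ := evTensor_surjective p z
    obtain ⟨a, rfl⟩ := evalAt_surjective (B := B) (F := B) p a
    obtain ⟨b, rfl⟩ := evalAt_surjective (B := B) (F := B) p b
    refine LinearMap.ext fun η ↦ ?_
    change Phi covT cov p ((evTensor B p v * ⁅ι ℝ (a p), ι ℝ (b p)⁆ * evTensor B p w) ⊗ₜ α) η = 0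
    rw [← evTensor_lie, ← map_mul, ← map_mul, Phi_evTensor, LinearMap.mem_ker.1 (h η v a b w),
      LinearMap.zero_apply]

theorem factorsThroughSym_iff_mem_formsVanish {p : M} :
    FactorsThroughSym covT cov p ↔ ∀ (η : AllForms B F V) (k : ℕ)
      (a b : VecField B M) (w : TensorAlgebra ℝ (VecField B M)),
      formsTensor covT cov (⁅ι ℝ a, ι ℝ b⁆ * w) η ∈ formsVanish cov p k :=
  (factorsThroughSym_iff_mem_ker_pairAt covT cov).trans
    (forall_congr' fun η ↦ higherTensor_commutator_mem_iff (G := AllForms B F V) η)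

theorem formsTensor_tensorDer_mem_formsVanish {p : M} {k : ℕ}
    {f : Module.End ℝ (VecField B M)} (hf : ∀ X, f X ∈ secVanish covT p k)
    (w : TensorAlgebra ℝ (VecField B M)) (η : AllForms B F V) :
    formsTensor covT cov (tensorDer f w) η ∈ formsVanish cov p k := by
  refine mem_of_tprod_mem (LinearMap.applyₗ η ∘ₗ formsTensor covT cov ∘ₗ tensorDer f)
    (fun j Y ↦ ?_) w
  change formsTensor covT cov (tensorDer f (tprod ℝ _ j Y)) η ∈ formsVanish cov p k
  rw [tensorDer_tprod, map_sum, LinearMap.sum_apply]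
  refine sum_mem fun i _ ↦ ?_
  rw [higherTensor_tprod]
  refine (isConnectionAt_nablaForms cov p).mem_vanish_of_tensorial covT
    (LinearMap.applyₗ η ∘ₗ (higherForms covT cov j).toLinearMap Y i)
    (fun f s ↦ ?_) (hf (Y i))
  exact higher_tensorial (G := AllForms B F V) (nablaT covT) (nablaForms cov) fmul formsMul
    dirDeriv (nabla_fmul_left covT) (fun f X Y ↦ nabla_fmul covT X f Y)
    (nablaForms_fmul_left cov) (nablaForms_formsMul cov) j Y i f s η

variable {covT}

theorem curvEnd_nablaForms_mem_formsVanish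
    (hT : ∀ a b, curvEnd (nablaSec covT) (dirDerivLin B M) a b = 0) {p : M} {k : ℕ}
    {a b : VecField B M}
    (hE : ∀ s, curvEnd (nablaSec covT) (nablaSec cov) a b s ∈ secVanish cov p k)
    (η : AllForms B F V) :
    curvEnd (nablaSec covT) (nablaForms cov) a b η ∈ formsVanish cov p k := by
  refine (mem_formsVanish_iff cov).2 fun t ↦ ?_
  rw [formTensor_curvEnd cov hT]
  refine neg_mem (mem_of_tprod_mem (formTensor B F V η ∘ₗ tensorDer _) (fun j Y ↦ ?_) t)
  rw [LinearMap.comp_apply, tensorDer_tprod, map_sum]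
  refine sum_mem fun i _ ↦ ?_
  rw [formTensor_tprod]
  exact (isConnectionAt_dirDerivLin p).mem_vanish_of_tensorial cov
    ((formAlt (η j)).toMultilinearMap.toLinearMap Y i)
    (fun f s ↦ app_update_fmul (η j) Y i f s) (hE (Y i))

theorem formsTensor_commutator_mul (a b : VecField B M) (w : TensorAlgebra ℝ (VecField B M))
    (η : AllForms B F V) :
    formsTensor covT cov (⁅ι ℝ a, ι ℝ b⁆ * w) η =
      curvEnd (nablaSec covT) (nablaForms cov) a b (formsTensor covT cov w η) -
        formsTensor covT cov (tensorDer (curvEnd (nablaSec covT) (nablaSec covT) a b) w) η := by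
  rw [higherTensor_commutator_mul]
  rfl

theorem FactorsThroughSym.curvEnd_tangent_mem_secVanish
    (hT : ∀ a b, curvEnd (nablaSec covT) (dirDerivLin B M) a b = 0) {p : M}
    (h : FactorsThroughSym covT cov p) (k : ℕ) (a b c : VecField B M) :
    curvEnd (nablaSec covT) (nablaSec covT) a b c ∈ secVanish covT p k := by
  refine mem_secVanish_of_forall_dirDeriv covT fun f ↦ ?_
  set Rc := curvEnd (nablaSec covT) (nablaSec covT) a b c
  have ricci :
      formTensor B F V (formsTensor covT cov (⁅ι ℝ a, ι ℝ b⁆ * ι ℝ c) (zeroForm F V f)) 1 =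
        -dirDeriv Rc f := by
    rw [formsTensor_commutator_mul]
    refine (LinearMap.congr_fun (map_sub (G := AllForms B F V) (formTensor B F V) _ _) 1).trans ?_
    rw [LinearMap.sub_apply, formTensor_curvEnd cov hT, tensorDer_one, map_zero, neg_zero,
      zero_sub, tensorDer_ι, higherTensor_ι, formTensor_nablaForms, tensorDer_one, map_zero,
      sub_zero, formTensor_zeroForm_one]
    rfl
  have mem := (mem_formsVanish_iff cov).1
    ((factorsThroughSym_iff_mem_formsVanish covT cov).1 h (zeroForm F V f) k a b (ι ℝ c)) 1
  rw [ricci] at mem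
  exact neg_mem_iff.1 mem

theorem FactorsThroughSym.curvEnd_bundle_mem_secVanish
    (hT : ∀ a b, curvEnd (nablaSec covT) (dirDerivLin B M) a b = 0) {p : M}
    (h : FactorsThroughSym covT cov p) (k : ℕ) (a b : VecField B M) (s : Sec B F V) :
    curvEnd (nablaSec covT) (nablaSec cov) a b s ∈ secVanish cov p k := by
  refine (mem_secVanish_iff_forall_formTensor cov).2 fun η ↦ ?_
  have mem := (mem_formsVanish_iff cov).1
    ((factorsThroughSym_iff_mem_formsVanish covT cov).1 h η k a b 1) (ι ℝ s)
  rw [mul_one, higherTensor_commutator, formTensor_curvEnd cov hT, tensorDer_ι] at mem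
  exact neg_mem_iff.1 mem

theorem factorsThroughSym_iff_asympFlat
    (hT : ∀ a b, curvEnd (nablaSec covT) (dirDerivLin B M) a b = 0) {p : M} :
    FactorsThroughSym covT cov p ↔ AsympFlat covT covT p ∧ AsympFlat covT cov p := by
  rw [asympFlat_iff, asympFlat_iff]
  refine ⟨fun h ↦ ⟨h.curvEnd_tangent_mem_secVanish cov hT, h.curvEnd_bundle_mem_secVanish cov hT⟩,
    fun ⟨tangent_flat, bundle_flat⟩ ↦ (factorsThroughSym_iff_mem_formsVanish covT cov).2
      fun η k a b w ↦ ?_⟩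
  rw [formsTensor_commutator_mul]
  exact Submodule.sub_mem (M := AllForms B F V) _
    (curvEnd_nablaForms_mem_formsVanish cov hT (bundle_flat k a b) _)
    (formsTensor_tensorDer_mem_formsVanish covT cov (tangent_flat k a b) w η)

/-- Paired with `1 ∈ ∧(V_p)`, forms enter through their components of degree `0`, which have no
curvature; hence commutators times `1` are in the kernel, and an ideal contains their multiples. -/
theorem KerIsIdeal.factorsThroughSym
    (hT : ∀ a b, curvEnd (nablaSec covT) (dirDerivLin B M) a b = 0) {p : M}
    (h : KerIsIdeal covT cov p) : FactorsThroughSym covT cov p := by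
  obtain ⟨J, hJ⟩ := h
  refine (factorsThroughSym_iff covT cov).2 fun y a b z α ↦ ?_
  have commutator_mem : ⁅ι ℝ a, ι ℝ b⁆ ⊗ₜ[ℝ] (1 : ExteriorAlgebra ℝ (V p)) ∈ J := by
    rw [hJ]
    obtain ⟨a, rfl⟩ := evalAt_surjective (B := B) (F := B) p a
    obtain ⟨b, rfl⟩ := evalAt_surjective (B := B) (F := B) p b
    refine LinearMap.ext fun η ↦ ?_
    change Phi covT cov p (⁅ι ℝ (a p), ι ℝ (b p)⁆ ⊗ₜ[ℝ] 1) η = 0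
    rw [← evTensor_lie, Phi_evTensor, higherTensor_commutator, pairAt_one,
      formTensor_curvEnd cov hT, tensorDer_one, map_zero, neg_zero]
    rfl
  have mul_mem := J.mul_mem_right _ (z ⊗ₜ α) (J.mul_mem_left (y ⊗ₜ 1) _ commutator_mem)
  rwa [Algebra.TensorProduct.tmul_mul_tmul, Algebra.TensorProduct.tmul_mul_tmul, one_mul,
    one_mul, hJ] at mul_mem

end Flatness

/-! ### Leading terms of higher covariant derivatives -/

theorem higherTensor_tprod_mem_vanish {X G : Type*} [AddCommGroup X] [Module ℝ X]
    [AddCommGroup G] [Module ℝ G] (nT : X →ₗ[ℝ] Module.End ℝ X) {n : X →ₗ[ℝ] Module.End ℝ G}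
    {Z : Submodule ℝ G} {j k : ℕ} (Y : Fin j → X) {s : G} (hs : s ∈ vanish n Z (k + j)) :
    higherTensor nT n (TensorAlgebra.tprod ℝ X j Y) s ∈ vanish n Z k := by
  induction j generalizing k with
  | zero => rwa [tprod_zero, higherTensor_one]
  | succ j ih =>
    rw [tprod_succ, higherTensor_ι_mul, tensorDer_tprod, map_sum, LinearMap.sub_apply,
      Module.End.mul_apply, LinearMap.sum_apply]
    refine sub_mem ((mem_vanish_succ.1 (ih (k := k + 1) _ ?_)).2 (Y 0))
      (sum_mem fun i _ ↦ ih _ (vanish_succ_le _ hs))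
    rwa [Nat.add_right_comm]

section Symbol

variable {B : Type*} [NormedAddCommGroup B] [NormedSpace ℝ B]
  {M : Type*} [TopologicalSpace M] [ChartedSpace B M] [IsManifold 𝓘(ℝ, B) ∞ M]
  {G W : Type*} [AddCommGroup G] [Module ℝ G] [AddCommGroup W] [Module ℝ W] {p : M}
  {e : G →ₗ[ℝ] W}

open TensorAlgebra (tprod)

theorem IsConnectionAt.mul_mem_vanish {m : C^∞⟮𝓘(ℝ, B), M; ℝ⟯ → G →+ G}
    {n : VecField B M → Module.End ℝ G} (hn : IsConnectionAt p e m n) {i j : ℕ}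
    {f : C^∞⟮𝓘(ℝ, B), M; ℝ⟯} {s : G} (hf : f ∈ funVanish B p i)
    (hs : s ∈ vanish n (LinearMap.ker e) j) : m f s ∈ vanish n (LinearMap.ker e) (i + j) := by
  obtain ⟨k, hk⟩ : ∃ k, i + j = k := ⟨_, rfl⟩
  rw [hk]
  induction k generalizing i j f s with
  | zero => exact mem_vanish_zero _
  | succ k ih =>
    refine mem_vanish_succ.2 ⟨?_, fun X ↦ ?_⟩
    · rw [LinearMap.mem_ker, hn.eval_mul]
      cases i with
      | zero =>
        obtain rfl : j = k + 1 := by lia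
        rw [LinearMap.mem_ker.1 (vanish_succ_le_zeros k hs), smul_zero]
      | succ i =>
        have eval_eq_zero : f p = 0 := vanish_succ_le_zeros i hf
        rw [eval_eq_zero, zero_smul]
    · rw [hn.leibniz]
      refine add_mem ?_ ?_
      · cases j with
        | zero => exact ih (vanish_succ_le k (by rwa [← hk])) (mem_vanish_zero _) (add_zero k)
        | succ j => exact ih hf ((mem_vanish_succ.1 hs).2 X) (by lia)
      · cases i with
        | zero =>
          obtain rfl : j = k + 1 := by lia
          exact ih (mem_vanish_zero _) (vanish_succ_le k hs) (zero_add k)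
        | succ i => exact ih ((mem_vanish_succ.1 hf).2 X) hs (by lia)

theorem IsConnectionAt.mul_mem_vanish_of_left {m : C^∞⟮𝓘(ℝ, B), M; ℝ⟯ → G →+ G}
    {n : VecField B M → Module.End ℝ G} (hn : IsConnectionAt p e m n) {i : ℕ}
    {f : C^∞⟮𝓘(ℝ, B), M; ℝ⟯} (hf : f ∈ funVanish B p i) (s : G) :
    m f s ∈ vanish n (LinearMap.ker e) i :=
  hn.mul_mem_vanish hf (mem_vanish_zero s)

theorem mul_mem_funVanish_of_right {i : ℕ} (f : C^∞⟮𝓘(ℝ, B), M; ℝ⟯) {g : C^∞⟮𝓘(ℝ, B), M; ℝ⟯}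
    (hg : g ∈ funVanish B p i) : f * g ∈ funVanish B p i :=
  mul_comm g f ▸ (isConnectionAt_dirDerivLin p).mul_mem_vanish_of_left hg f

theorem pow_mem_funVanish {g : C^∞⟮𝓘(ℝ, B), M; ℝ⟯} (hg : g p = 0) (k : ℕ) :
    g ^ k ∈ funVanish B p k := by
  induction k with
  | zero => exact mem_vanish_zero _
  | succ k ih =>
    have g_mem : g ∈ funVanish B p 1 := mem_vanish_succ.2 ⟨hg, fun _ ↦ mem_vanish_zero _⟩
    exact pow_succ g k ▸ (isConnectionAt_dirDerivLin p).mul_mem_vanish ih g_mem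

theorem dirDeriv_pow_succ (X : VecField B M) (g : C^∞⟮𝓘(ℝ, B), M; ℝ⟯) (k : ℕ) :
    dirDeriv X (g ^ (k + 1)) = (k + 1) • (g ^ k * dirDeriv X g) := by
  induction k with
  | zero => simp only [zero_add, pow_one, one_nsmul, pow_zero, one_mul]
  | succ k ih =>
    rw [pow_succ, dirDeriv_mul, ih]
    simp only [nsmul_eq_mul]
    push_cast
    ring

variable {m : C^∞⟮𝓘(ℝ, B), M; ℝ⟯ →+ G →+ G} {nT : VecField B M →ₗ[ℝ] Module.End ℝ (VecField B M)}
  {n : VecField B M →ₗ[ℝ] Module.End ℝ G}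

theorem IsConnectionAt.deriv_sub_mem_vanish (hn : IsConnectionAt p e m n)
    {g : C^∞⟮𝓘(ℝ, B), M; ℝ⟯} (hg : g p = 0) {k : ℕ} {f : C^∞⟮𝓘(ℝ, B), M; ℝ⟯} {s η : G}
    (hs : s - m (f * g ^ (k + 1)) η ∈ vanish n (LinearMap.ker e) (k + 2)) (X : VecField B M) :
    n X s - m ((k + 1) • (f * dirDeriv X g * g ^ k)) η ∈ vanish n (LinearMap.ker e) (k + 1) := by
  have pow_mem := pow_mem_funVanish hg (k + 1)
  have leibniz : dirDeriv X (f * g ^ (k + 1)) =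
      (k + 1) • (f * dirDeriv X g * g ^ k) + dirDeriv X f * g ^ (k + 1) := by
    rw [dirDeriv_mul, dirDeriv_pow_succ]
    simp only [nsmul_eq_mul]
    ring
  have deriv_mem := (mem_vanish_succ.1 hs).2 X
  rw [map_sub, hn.leibniz, leibniz, map_add, AddMonoidHom.add_apply] at deriv_mem
  have left_mem := hn.mul_mem_vanish_of_left (mul_mem_funVanish_of_right f pow_mem) (n X η)
  have right_mem :=
    hn.mul_mem_vanish_of_left (mul_mem_funVanish_of_right (dirDeriv X f) pow_mem) η
  convert add_mem deriv_mem (add_mem left_mem right_mem) using 1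
  abel

theorem IsConnectionAt.higherTensor_pow_sub_mem_vanish (hn : IsConnectionAt p e m n)
    {g : C^∞⟮𝓘(ℝ, B), M; ℝ⟯} (hg : g p = 0) (η : G) {j : ℕ} (Y : Fin j → VecField B M) (k : ℕ) :
    higherTensor nT n (tprod ℝ _ j Y) (m (g ^ (k + j)) η) -
      m ((k + j).descFactorial j • (∏ i, dirDeriv (Y i) g) * g ^ k) η ∈
        vanish n (LinearMap.ker e) (k + 1) := by
  induction j generalizing k with
  | zero => simp
  | succ j ih =>
    rw [tprod_succ, higherTensor_ι_mul, tensorDer_tprod, map_sum, LinearMap.sub_apply,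
      Module.End.mul_apply, LinearMap.sum_apply, Fin.prod_univ_succ, sub_right_comm]
    refine sub_mem ?_ (sum_mem fun i _ ↦ higherTensor_tprod_mem_vanish nT _ ?_)
    · have leading := hn.deriv_sub_mem_vanish hg (ih (Fin.tail Y) (k + 1)) (Y 0)
      have descFactorial_succ : (k + (j + 1)).descFactorial (j + 1) =
          (k + 1) * (k + (j + 1)).descFactorial j := by
        rw [Nat.descFactorial_succ]
        congr 1
        lia
      rw [show k + 1 + j = k + (j + 1) by lia] at leading
      convert leading using 4
      simp only [descFactorial_succ, nsmul_eq_mul, Fin.tail]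
      push_cast
      ring
    · rw [show k + 1 + j = k + (j + 1) by lia]
      exact hn.mul_mem_vanish_of_left (pow_mem_funVanish hg _) η

end Symbol

/-! ### Symmetric algebras -/

section SymmetricAlgebra

variable {X : Type*} [AddCommGroup X] [Module ℝ X] {W : Type*} [AddCommGroup W] [Module ℝ W]

open TensorAlgebra (ι tprod)

theorem iSup_tensorLE : ⨆ r, tensorLE X r = ⊤ := by
  refine top_le_iff.1 ?_
  rw [← (DirectSum.Decomposition.isInternal
    (fun i ↦ LinearMap.range (ι ℝ (M := X)) ^ i)).submodule_iSup_eq_top]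
  exact iSup_mono fun r ↦ le_iSup₂_of_le r le_rfl le_rfl

theorem map_tensorLE (r : ℕ) :
    (tensorLE X r).map (SymmetricAlgebra.algHom ℝ X).toLinearMap = symLE X r := by
  simp only [tensorLE, symLE, Submodule.map_iSup, Submodule.map_pow, ← LinearMap.range_comp]
  rfl

theorem iSup_symLE : ⨆ r, symLE X r = ⊤ := by
  simp only [← map_tensorLE, ← Submodule.map_iSup, iSup_tensorLE, Submodule.map_top]
  exact LinearMap.range_eq_top.2 (SymmetricAlgebra.algHom_surjective ℝ X)

theorem symLE_mono : Monotone (symLE X) := fun _ _ h ↦ biSup_mono fun _ hi ↦ hi.trans h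

theorem exists_mem_box_symLE (z : SymmetricAlgebra ℝ X ⊗[ℝ] W) : ∃ r, z ∈ box (symLE X r) ⊤ := by
  have h_top : ⨆ r, box (symLE X r) (⊤ : Submodule ℝ W) = ⊤ := by
    simp only [box, ← Submodule.map₂_iSup_left, iSup_symLE]
    exact TensorProduct.map₂_mk_top_top_eq_top ℝ _ _
  have h_mono : Monotone fun r ↦ box (symLE X r) (⊤ : Submodule ℝ W) :=
    fun _ _ h ↦ Submodule.map₂_le_map₂_left (symLE_mono h)
  exact (Submodule.mem_iSup_of_directed _ h_mono.directed_le).1 (h_top ▸ Submodule.mem_top)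

theorem algHom_tprod {r : ℕ} (v : Fin r → X) :
    SymmetricAlgebra.algHom ℝ X (tprod ℝ X r v) = ∏ i, SymmetricAlgebra.ι ℝ X (v i) := by
  rw [TensorAlgebra.tprod_apply, map_list_prod, List.map_ofFn, List.prod_ofFn]
  rfl

theorem range_ι_pow_eq_span (r : ℕ) : LinearMap.range (SymmetricAlgebra.ι ℝ X) ^ r =
    Submodule.span ℝ (Set.range fun v : Fin r → X ↦ ∏ i, SymmetricAlgebra.ι ℝ X (v i)) := by
  rw [Submodule.pow_eq_span_pow_set]
  congr 1
  ext a
  simp only [Set.mem_pow, List.prod_ofFn, Set.mem_range]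
  constructor
  · rintro ⟨f, rfl⟩
    choose v hv using fun i ↦ (f i).2
    exact ⟨v, by simp only [hv]⟩
  · rintro ⟨v, rfl⟩
    exact ⟨fun i ↦ ⟨_, v i, rfl⟩, rfl⟩

theorem box_range_ι_pow_le {r : ℕ} {N : Submodule ℝ (SymmetricAlgebra ℝ X ⊗[ℝ] W)}
    (h : ∀ (v : Fin r → X) (α : W), (∏ i, SymmetricAlgebra.ι ℝ X (v i)) ⊗ₜ α ∈ N) :
    box (LinearMap.range (SymmetricAlgebra.ι ℝ X) ^ r) ⊤ ≤ N := by
  rw [box, range_ι_pow_eq_span, ← Submodule.span_univ, Submodule.map₂_span_span,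
    Submodule.span_le]
  rintro - ⟨-, ⟨v, rfl⟩, α, -, rfl⟩
  exact h v α

theorem eq_zero_of_forall_lift_eq_zero {a : SymmetricAlgebra ℝ X}
    (h : ∀ ξ : X →ₗ[ℝ] ℝ, SymmetricAlgebra.lift ξ a = 0) : a = 0 := by
  let b := Module.Basis.ofVectorSpace ℝ X
  let φ := SymmetricAlgebra.equivMvPolynomial b
  have aeval_comp (x : _ → ℝ) :
      (MvPolynomial.aeval x).comp φ.toAlgHom = SymmetricAlgebra.lift (b.constr ℝ x) :=
    SymmetricAlgebra.algHom_ext (b.ext fun i ↦ by simp [φ])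
  rw [← φ.map_eq_zero_iff]
  refine MvPolynomial.funext fun x ↦ ?_
  rw [map_zero, ← h (b.constr ℝ x), ← aeval_comp]
  rfl

/-- The evaluation of an element of `S(X) ⊠ W`, seen as a `W`-valued polynomial function on the
dual of `X`, at a covector `ξ`, paired with a functional `φ` on `W`. -/
def polyEval (ξ : X →ₗ[ℝ] ℝ) (φ : W →ₗ[ℝ] ℝ) : SymmetricAlgebra ℝ X ⊗[ℝ] W →ₗ[ℝ] ℝ :=
  LinearMap.mul' ℝ ℝ ∘ₗ TensorProduct.map (SymmetricAlgebra.lift ξ).toLinearMap φ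

theorem polyEval_tmul (ξ : X →ₗ[ℝ] ℝ) (φ : W →ₗ[ℝ] ℝ) (a : SymmetricAlgebra ℝ X) (α : W) :
    polyEval ξ φ (a ⊗ₜ α) = SymmetricAlgebra.lift ξ a * φ α := rfl

theorem eq_zero_of_forall_polyEval_eq_zero {z : SymmetricAlgebra ℝ X ⊗[ℝ] W}
    (h : ∀ ξ φ, polyEval ξ φ z = 0) : z = 0 := by
  classical
  let b := Module.Basis.ofVectorSpace ℝ W
  let Q := TensorProduct.equivFinsuppOfBasisRight (M := SymmetricAlgebra ℝ X) b
  have polyEval_coord (ξ : X →ₗ[ℝ] ℝ) (i) :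
      (SymmetricAlgebra.lift ξ).toLinearMap ∘ₗ Finsupp.lapply i ∘ₗ Q.toLinearMap =
        polyEval ξ (b.coord i) :=
    TensorProduct.ext' fun a α ↦ by simp [Q, polyEval_tmul, mul_comm]
  rw [← Q.map_eq_zero_iff]
  exact Finsupp.ext fun i ↦ eq_zero_of_forall_lift_eq_zero fun ξ ↦
    (LinearMap.congr_fun (polyEval_coord ξ i) z).trans (h ξ _)

theorem injective_of_leading_terms {D : Type*} [AddCommMonoid D] [Module ℝ D]
    {Ψ : SymmetricAlgebra ℝ X ⊗[ℝ] W →ₗ[ℝ] D}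
    (h : ∀ (r : ℕ) (ξ : X →ₗ[ℝ] ℝ) (φ : W →ₗ[ℝ] ℝ), ∃ (δ : D →ₗ[ℝ] ℝ) (c : ℝ), c ≠ 0 ∧
      (∀ j < r, ∀ (v : Fin j → X) α, δ (Ψ ((∏ i, SymmetricAlgebra.ι ℝ X (v i)) ⊗ₜ α)) = 0) ∧
      ∀ (v : Fin r → X) α, δ (Ψ ((∏ i, SymmetricAlgebra.ι ℝ X (v i)) ⊗ₜ α)) =
        c * ((∏ i, ξ (v i)) * φ α)) :
    Injective Ψ := by
  have eq_zero_of_mem (r : ℕ) : ∀ z ∈ box (⨆ j < r, LinearMap.range (SymmetricAlgebra.ι ℝ X) ^ j) ⊤,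
      Ψ z = 0 → z = 0 := by
    induction r with
    | zero => simp [box]
    | succ r ih =>
      intro z hz hΨz
      rw [Nat.iSup_lt_succ, box, Submodule.map₂_sup_left] at hz
      obtain ⟨l, hl, a, ha, rfl⟩ := Submodule.mem_sup.1 hz
      have ha_zero : a = 0 := eq_zero_of_forall_polyEval_eq_zero fun ξ φ ↦ by
        obtain ⟨δ, c, hc, h_lower, h_leading⟩ := h r ξ φ
        have hδl : box (⨆ j < r, LinearMap.range (SymmetricAlgebra.ι ℝ X) ^ j) ⊤ ≤
            LinearMap.ker (δ ∘ₗ Ψ) := by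
          simp only [box, Submodule.map₂_iSup_left]
          exact iSup₂_le fun j hj ↦ box_range_ι_pow_le (h_lower j hj)
        have hδa : box (LinearMap.range (SymmetricAlgebra.ι ℝ X) ^ r) ⊤ ≤
            LinearMap.eqLocus (δ ∘ₗ Ψ) (c • polyEval ξ φ) :=
          box_range_ι_pow_le fun v α ↦ by simpa [polyEval_tmul] using h_leading v α
        have hδ : δ (Ψ l) + δ (Ψ a) = 0 := by rw [← map_add, ← map_add, hΨz, map_zero]
        rw [show δ (Ψ l) = 0 from hδl hl, zero_add,
          show δ (Ψ a) = c * polyEval ξ φ a from hδa ha] at hδ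
        exact (mul_eq_zero.1 hδ).resolve_left hc
      rw [ha_zero, add_zero] at hΨz ⊢
      exact ih l hl hΨz
  refine (injective_iff_map_eq_zero Ψ).2 fun z ↦ ?_
  obtain ⟨r, hr⟩ := exists_mem_box_symLE z
  simp only [symLE, ← Nat.lt_succ_iff] at hr
  exact eq_zero_of_mem (r + 1) z hr

end SymmetricAlgebra

section FormsMul

variable {B : Type*} [NormedAddCommGroup B] [NormedSpace ℝ B]
  {M : Type*} [TopologicalSpace M] [ChartedSpace B M]
  {F : Type*} [NormedAddCommGroup F] [NormedSpace ℝ F]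
  {V : M → Type*} [TopologicalSpace (TotalSpace F V)]
  [∀ x, AddCommGroup (V x)] [∀ x, Module ℝ (V x)] [∀ x, TopologicalSpace (V x)]
  [FiberBundle F V]

theorem formsMul_zero_left : formsMul (0 : C^∞⟮𝓘(ℝ, B), M; ℝ⟯) = (0 : AllForms B F V →+ _) :=
  AddMonoidHom.ext fun η ↦ funext fun k ↦ Subtype.ext <| funext fun x ↦ zero_smul ℝ ((η k).1 x)

theorem formsMul_add_left (f g : C^∞⟮𝓘(ℝ, B), M; ℝ⟯) :
    (formsMul (f + g) : AllForms B F V →+ _) = formsMul f + formsMul g :=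
  AddMonoidHom.ext fun η ↦ funext fun k ↦ Subtype.ext <| funext fun x ↦
    add_smul (f x) (g x) ((η k).1 x)

variable (B F V) in
/-- Multiplication of forms by functions, `formsMul`, as a biadditive map. -/
def formsMulHom : C^∞⟮𝓘(ℝ, B), M; ℝ⟯ →+ AllForms B F V →+ AllForms B F V where
  toFun := formsMul
  map_zero' := formsMul_zero_left
  map_add' := formsMul_add_left

end FormsMul

section ToSym

variable (B : Type*) [NormedAddCommGroup B] [NormedSpace ℝ B]
  {M : Type*} [TopologicalSpace M] [ChartedSpace B M]
  (V : M → Type*) [∀ x, AddCommGroup (V x)] [∀ x, Module ℝ (V x)]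

theorem toSym_surjective (p : M) : Surjective (toSym B V p) :=
  TensorProduct.map_surjective (SymmetricAlgebra.algHom_surjective ℝ _) surjective_id

theorem map_toSym_box (p : M) (r k : ℕ) :
    (box (tensorLE (TangentSpace 𝓘(ℝ, B) p) r) (⋀[ℝ]^k (V p))).map (toSym B V p) =
      box (symLE (TangentSpace 𝓘(ℝ, B) p) r) (⋀[ℝ]^k (V p)) := by
  rw [← map_tensorLE, box, box, Submodule.map_map₂]
  conv_rhs => rw [← Submodule.map_id (⋀[ℝ]^k (V p)), Submodule.map₂_map_map]
  rfl

end ToSym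

section Isomorphism

variable {B : Type*} [NormedAddCommGroup B] [NormedSpace ℝ B] [FiniteDimensional ℝ B]
  {M : Type*} [TopologicalSpace M] [T2Space M] [ChartedSpace B M] [IsManifold 𝓘(ℝ, B) ∞ M]
  {F : Type*} [NormedAddCommGroup F] [NormedSpace ℝ F] [FiniteDimensional ℝ F]
  {V : M → Type*} [TopologicalSpace (TotalSpace F V)]
  [∀ x, AddCommGroup (V x)] [∀ x, Module ℝ (V x)] [∀ x, TopologicalSpace (V x)]
  [∀ x, IsTopologicalAddGroup (V x)] [∀ x, ContinuousSMul ℝ (V x)]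
  [FiberBundle F V] [VectorBundle ℝ F V]
  [ContMDiffVectorBundle ∞ F V 𝓘(ℝ, B)]
  (covT : CovariantDerivative 𝓘(ℝ, B) B (TangentSpace 𝓘(ℝ, B) : M → Type _))
  [CovariantDerivative.ContMDiffCovariantDerivative covT ∞]
  (cov : CovariantDerivative 𝓘(ℝ, B) F V)
  [CovariantDerivative.ContMDiffCovariantDerivative cov ∞]

open TensorAlgebra (tprod)

theorem isConnectionAt_formsMulHom (p : M) :
    IsConnectionAt (G := AllForms B F V) p (pairAt B F p) (formsMulHom B F V) (nablaForms cov) :=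
  isConnectionAt_nablaForms cov p

theorem Phi_tprod_pow_of_lt {p : M} {g : C^∞⟮𝓘(ℝ, B), M; ℝ⟯} (hg : g p = 0) {j r : ℕ}
    (hj : j < r) (Y : Fin j → VecField B M) (α : ExteriorAlgebra ℝ (V p)) (η : AllForms B F V) :
    Phi covT cov p (tprod ℝ _ j (fun i ↦ Y i p) ⊗ₜ α) (formsMulHom B F V (g ^ r) η) = 0 := by
  obtain ⟨d, rfl⟩ : ∃ d, r = d + 1 + j := ⟨r - j - 1, by omega⟩
  have pow_mul_mem : formsMulHom B F V (g ^ (d + 1 + j)) η ∈ formsVanish cov p (d + 1 + j) :=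
    (isConnectionAt_formsMulHom cov p).mul_mem_vanish_of_left (pow_mem_funVanish hg _) η
  have deriv_mem : formsTensor covT cov (tprod ℝ _ j Y) (formsMulHom B F V (g ^ (d + 1 + j)) η) ∈
      LinearMap.ker (pairAt B F p) :=
    vanish_succ_le_zeros d (higherTensor_tprod_mem_vanish (nablaSec covT) Y pow_mul_mem)
  rw [← evTensor_tprod, Phi_evTensor, LinearMap.mem_ker.1 deriv_mem, LinearMap.zero_apply]

theorem Phi_tprod_pow {p : M} {g : C^∞⟮𝓘(ℝ, B), M; ℝ⟯} (hg : g p = 0) {r : ℕ}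
    (Y : Fin r → VecField B M) (α : ExteriorAlgebra ℝ (V p)) (η : AllForms B F V) :
    Phi covT cov p (tprod ℝ _ r (fun i ↦ Y i p) ⊗ₜ α) (formsMulHom B F V (g ^ r) η) =
      r.factorial * ((∏ i, dirDeriv (Y i) g p) * pairAt B F p η α) := by
  have leading := vanish_succ_le_zeros 0 <|
    (isConnectionAt_formsMulHom cov p).higherTensor_pow_sub_mem_vanish
      (nT := nablaSec covT) hg η Y 0
  rw [LinearMap.mem_ker, map_sub, sub_eq_zero, zero_add, Nat.descFactorial_self, pow_zero,
    mul_one, (isConnectionAt_formsMulHom cov p).eval_mul] at leading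
  have eval_symbol : (r.factorial • ∏ i, dirDeriv (Y i) g : C^∞⟮𝓘(ℝ, B), M; ℝ⟯) p =
      r.factorial * ∏ i, dirDeriv (Y i) g p := by
    let ev := (ContMDiffMap.evalRingHom p : C^∞⟮𝓘(ℝ, B), M; ℝ⟯ →+* ℝ)
    rw [← nsmul_eq_mul]
    exact (map_nsmul ev _ _).trans (congrArg _ (map_prod ev _ _))
  rw [← evTensor_tprod, Phi_evTensor, leading, eval_symbol, LinearMap.smul_apply, smul_eq_mul,
    mul_assoc]

variable {covT cov}

theorem injective_of_Phi_eq {p : M}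
    {Ψ : SymmetricAlgebra ℝ (TangentSpace 𝓘(ℝ, B) p) ⊗[ℝ] ExteriorAlgebra ℝ (V p) →ₗ[ℝ]
      Module.Dual ℝ (AllForms B F V)} (hΨ : Phi covT cov p = Ψ ∘ₗ toSym B V p) :
    Injective Ψ := by
  have Ψ_prod {j : ℕ} (Y : Fin j → VecField B M) (α : ExteriorAlgebra ℝ (V p)) :
      Ψ ((∏ i, SymmetricAlgebra.ι ℝ _ (Y i p)) ⊗ₜ α) =
        Phi covT cov p (tprod ℝ _ j (fun i ↦ Y i p) ⊗ₜ α) := by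
    rw [← algHom_tprod, hΨ]
    rfl
  have exists_extension {j : ℕ} (v : Fin j → TangentSpace 𝓘(ℝ, B) p) :
      ∃ Y : Fin j → VecField B M, v = fun i ↦ Y i p :=
    ⟨fun i ↦ extSec p (v i), funext fun i ↦ (extSec_apply_self p (v i)).symm⟩
  refine injective_of_leading_terms fun r ξ φ ↦ ?_
  obtain ⟨η, rfl⟩ := exists_pairAt_eq (B := B) (F := F) p φ
  obtain ⟨g, hg, hξ⟩ := exists_dirDeriv_eq p ξ
  refine ⟨LinearMap.applyₗ (formsMulHom B F V (g ^ r) η), r.factorial,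
    Nat.cast_ne_zero.2 r.factorial_ne_zero, fun j hj v α ↦ ?_, fun v α ↦ ?_⟩
  · obtain ⟨Y, rfl⟩ := exists_extension v
    rw [Ψ_prod]
    exact Phi_tprod_pow_of_lt covT cov hg hj Y α η
  · obtain ⟨Y, rfl⟩ := exists_extension v
    rw [Ψ_prod]
    simp only [← hξ]
    exact Phi_tprod_pow covT cov hg Y α η

theorem FactorsThroughSym.kerIsIdeal {p : M} (h : FactorsThroughSym covT cov p) :
    KerIsIdeal covT cov p := by
  obtain ⟨Ψ, hΨ⟩ := h
  refine ⟨TwoSidedIdeal.ker (Algebra.TensorProduct.map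
    (SymmetricAlgebra.algHom ℝ (TangentSpace 𝓘(ℝ, B) p))
    (AlgHom.id ℝ (ExteriorAlgebra ℝ (V p)))), fun z ↦ ?_⟩
  rw [TwoSidedIdeal.mem_ker, LinearMap.mem_ker, hΨ, LinearMap.comp_apply,
    map_eq_zero_iff Ψ (injective_of_Phi_eq hΨ)]
  rfl

variable (covT cov) in
theorem range_Phi (p : M) : LinearMap.range (Phi covT cov p) = UTotal covT cov p := by
  have iSup_box : ⨆ (r : ℕ) (k : ℕ), box (tensorLE (TangentSpace 𝓘(ℝ, B) p) r) (⋀[ℝ]^k (V p)) =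
      ⊤ := by
    simp only [box, ← Submodule.map₂_iSup_right, ← Submodule.map₂_iSup_left, iSup_tensorLE,
      (DirectSum.Decomposition.isInternal (fun i ↦ ⋀[ℝ]^i (V p))).submodule_iSup_eq_top]
    exact TensorProduct.map₂_mk_top_top_eq_top ℝ _ _
  rw [LinearMap.range_eq_map, ← iSup_box]
  simp only [Submodule.map_iSup]
  rfl

theorem FactorsThroughSym.exists_equiv {p : M} (h : FactorsThroughSym covT cov p) :
    ∃ Ψ : SymmetricAlgebra ℝ (TangentSpace 𝓘(ℝ, B) p) ⊗[ℝ] ExteriorAlgebra ℝ (V p) ≃ₗ[ℝ]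
        UTotal covT cov p,
      (∀ z, (Ψ (toSym B V p z) : Module.Dual ℝ (AllForms B F V)) = Phi covT cov p z) ∧
      ∀ r k : ℕ, (box (symLE (TangentSpace 𝓘(ℝ, B) p) r) (⋀[ℝ]^k (V p))).map
        ((UTotal covT cov p).subtype ∘ₗ Ψ.toLinearMap) = U covT cov p r k := by
  obtain ⟨Ψ, hΨ⟩ := h
  have range_Ψ : LinearMap.range Ψ = UTotal covT cov p := by
    rw [← range_Phi, hΨ, LinearMap.range_comp_of_range_eq_top _
      (LinearMap.range_eq_top.2 (toSym_surjective B V p))]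
  let e := (LinearEquiv.ofInjective Ψ (injective_of_Phi_eq hΨ)).trans (LinearEquiv.ofEq _ _ range_Ψ)
  have subtype_comp_e : (UTotal covT cov p).subtype ∘ₗ e.toLinearMap = Ψ := rfl
  refine ⟨e, fun z ↦ ?_, fun r k ↦ ?_⟩
  · rw [hΨ]
    rfl
  · rw [subtype_comp_e, U, hΨ, Submodule.map_comp, map_toSym_box]

end Isomorphism

end CovJet

end

theorem mainTheorem2_general
    {B : Type*} [NormedAddCommGroup B] [NormedSpace ℝ B] [FiniteDimensional ℝ B]
    {M : Type*} [TopologicalSpace M] [T2Space M] [ChartedSpace B M]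
    [IsManifold 𝓘(ℝ, B) ∞ M]
    {F : Type*} [NormedAddCommGroup F] [NormedSpace ℝ F] [FiniteDimensional ℝ F]
    {E : M → Type*} [TopologicalSpace (TotalSpace F E)]
    [∀ x, AddCommGroup (E x)] [∀ x, Module ℝ (E x)] [∀ x, TopologicalSpace (E x)]
    [∀ x, IsTopologicalAddGroup (E x)] [∀ x, ContinuousSMul ℝ (E x)]
    [FiberBundle F E] [VectorBundle ℝ F E]
    [ContMDiffVectorBundle ∞ F E 𝓘(ℝ, B)]
    (covT : CovariantDerivative 𝓘(ℝ, B) B (TangentSpace 𝓘(ℝ, B) : M → Type _))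
    [CovariantDerivative.ContMDiffCovariantDerivative covT ∞]
    (htorsion : covT.torsion = 0)
    (cov : CovariantDerivative 𝓘(ℝ, B) F E)
    [CovariantDerivative.ContMDiffCovariantDerivative cov ∞]
    (p : M) :
    List.TFAE [CovJet.KerIsIdeal covT cov p,
      CovJet.AsympFlat covT covT p ∧ CovJet.AsympFlat covT cov p,
      CovJet.FactorsThroughSym covT cov p] ∧
    (CovJet.KerIsIdeal covT cov p ∨
        (CovJet.AsympFlat covT covT p ∧ CovJet.AsympFlat covT cov p) ∨
        CovJet.FactorsThroughSym covT cov p →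
      ∃ Ψ : SymmetricAlgebra ℝ (TangentSpace 𝓘(ℝ, B) p) ⊗[ℝ] ExteriorAlgebra ℝ (E p) ≃ₗ[ℝ]
          CovJet.UTotal covT cov p,
        (∀ z, (Ψ (CovJet.toSym B E p z) : Module.Dual ℝ (CovJet.AllForms B F E)) =
          CovJet.Phi covT cov p z) ∧
        ∀ r k : ℕ,
          (CovJet.box (CovJet.symLE (TangentSpace 𝓘(ℝ, B) p) r) (⋀[ℝ]^k (E p))).map
            ((CovJet.UTotal covT cov p).subtype ∘ₗ Ψ.toLinearMap) =
          CovJet.U covT cov p r k) := by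
  have functions_flat := CovJet.curvEnd_dirDerivLin htorsion
  have factors_of_ideal : CovJet.KerIsIdeal covT cov p → CovJet.FactorsThroughSym covT cov p :=
    CovJet.KerIsIdeal.factorsThroughSym cov functions_flat
  have factors_iff_flat := CovJet.factorsThroughSym_iff_asympFlat cov functions_flat (p := p)
  refine ⟨?_, ?_⟩
  · tfae_have 1 → 3 := factors_of_ideal
    tfae_have 3 ↔ 2 := factors_iff_flat
    tfae_have 3 → 1 := CovJet.FactorsThroughSym.kerIsIdeal
    tfae_finish
  · rintro (ideal | flat | factors)
    · exact (factors_of_ideal ideal).exists_equiv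
    · exact (factors_iff_flat.2 flat).exists_equiv
    · exact factors.exists_equiv

theorem mainTheorem2 {n : ℕ}
    {M : Type*} [TopologicalSpace M] [T2Space M] [ChartedSpace (EuclideanSpace ℝ (Fin n)) M]
    [IsManifold 𝓘(ℝ, EuclideanSpace ℝ (Fin n)) ∞ M]
    {F : Type*} [NormedAddCommGroup F] [NormedSpace ℝ F] [FiniteDimensional ℝ F]
    {E : M → Type*} [TopologicalSpace (TotalSpace F E)]
    [∀ x, AddCommGroup (E x)] [∀ x, Module ℝ (E x)] [∀ x, TopologicalSpace (E x)]
    [∀ x, IsTopologicalAddGroup (E x)] [∀ x, ContinuousSMul ℝ (E x)]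
    [FiberBundle F E] [VectorBundle ℝ F E]
    [ContMDiffVectorBundle ∞ F E 𝓘(ℝ, EuclideanSpace ℝ (Fin n))]
    (covT : CovariantDerivative 𝓘(ℝ, EuclideanSpace ℝ (Fin n)) (EuclideanSpace ℝ (Fin n))
      (TangentSpace 𝓘(ℝ, EuclideanSpace ℝ (Fin n)) : M → Type _))
    [CovariantDerivative.ContMDiffCovariantDerivative covT ∞]
    (htorsion : covT.torsion = 0)
    (cov : CovariantDerivative 𝓘(ℝ, EuclideanSpace ℝ (Fin n)) F E)
    [CovariantDerivative.ContMDiffCovariantDerivative cov ∞]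
    (p : M) :
    List.TFAE [CovJet.KerIsIdeal covT cov p,
      CovJet.AsympFlat covT covT p ∧ CovJet.AsympFlat covT cov p,
      CovJet.FactorsThroughSym covT cov p] ∧
    (CovJet.KerIsIdeal covT cov p ∨
        (CovJet.AsympFlat covT covT p ∧ CovJet.AsympFlat covT cov p) ∨
        CovJet.FactorsThroughSym covT cov p →
      ∃ Ψ : SymmetricAlgebra ℝ (TangentSpace 𝓘(ℝ, EuclideanSpace ℝ (Fin n)) p) ⊗[ℝ]
          ExteriorAlgebra ℝ (E p) ≃ₗ[ℝ] CovJet.UTotal covT cov p,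
        (∀ z, (Ψ (CovJet.toSym (EuclideanSpace ℝ (Fin n)) E p z) :
          Module.Dual ℝ (CovJet.AllForms (EuclideanSpace ℝ (Fin n)) F E)) =
            CovJet.Phi covT cov p z) ∧
        ∀ r k : ℕ,
          (CovJet.box (CovJet.symLE (TangentSpace 𝓘(ℝ, EuclideanSpace ℝ (Fin n)) p) r)
            (⋀[ℝ]^k (E p))).map ((CovJet.UTotal covT cov p).subtype ∘ₗ Ψ.toLinearMap) =
          CovJet.U covT cov p r k) :=
  mainTheorem2_general covT htorsion cov p
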